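/- **Setting.** Let $G$ be a parent graph on $V=\{1,\dots,d\}$: a directed acyclic graph in which every arrow $i\leftarrow k$ satisfies $i<k$ (connectedness is not needed). Let $C,M\subseteq V$ be disjoint (conditioning and marginalising set). Let $F$ be the set of ancestors of $C$ outside $C$, $R=C\cup F$, $O=V\setminus R$, and $u=O\setminus M$, $p=O\cap M$, $v=F\setminus M$, $q=F\cap M$, so that $V\setminus(C\cup M)=u\cup v$. *Summary graph.* For a binary matrix $\mathcal F$, $\operatorname{zer}_a\mathcal F$ is $\mathcal F$ with additional ones at all $(i,k)$ joined by a path $i,s,\dots,t,k$ of $\mathcal F$ with inner nodes $s,\dots,t$ in $a$. Let $\mathcal A$ be the edge matrix of $G$ with unit diagonal, $\mathcal D=\operatorname{zer}_p\mathcal A$, and $\mathcal Z=\operatorname{zer}_q\operatorname{In}[\mathcal A_{RR}^{T}\mathcal A_{RR}]_{FF}$, where $\operatorname{In}$ turns non-zero entries into ones. The summary graph on $u\cup v$ has arrows $i\leftarrow k$ ($i\in u$) given by $\mathcal H_{uu}=\mathcal D_{uu}$ and $\mathcal H_{uv}=\operatorname{In}[\mathcal D_{uv}+\mathcal D_{uq}\mathcal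 Z_{qv}]$, dashed lines within $u$ given by $\mathcal W_{uu}=\operatorname{In}[\mathcal I+\mathcal D_{up}\mathcal D_{up}^{T}+\mathcal D_{uq}\mathcal Z_{qq}\mathcal D_{uq}^{T}]$, and full lines within $v$ given by $\mathcal Z_{vv}$. For $i\in u$ let $c_i$ be the set of ancestors of $i$ in $u$ and $m_i=u\setminus c_i$. *Active paths.* A path has distinct nodes and specified edges. An inner node is a collision node if each of the two neighbouring edges of the path is there an arrowhead or the end of a dashed line; otherwise it is a transmitting node. A path is active relative to $[c,m]$ if every inner transmitting node is in $m$ and every inner collision node is in $c$ or has a descendant in $c$ (so a single edge is always active). The path consisting of the arrow $i\leftarrow k$ alone, which is the dependence under study, is disregarded below. *Models.* Let $Y=(Y_1,\dots,Y_d)$ be a mean-centred square-integrable random vector (for example Gaussian) with $AY=\varepsilon$, where $A$ has unit diagonal, $A_{ik}=0$ for $i\ne k$ unless $i\leftarrow k$ in $G$, and the residuals $\varepsilon_i$ are uncorrelated with variances $\Delta_i>0$; the generating dependence of $Y_i$ on $Y_k$ is $-A_{ik}$. The summary graph model given $Y_C$ has equations $H_{uu}Y_u+H_{uv}Y_v=\eta_u$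 with $\operatorname{cov}(\eta_u)=W_{uu}$, where, with $D=\operatorname{inv}_pA$ (partial inversion) and $\operatorname{inv}_q[A_{RR}^T\Delta_{RR}^{-1}A_{RR}]_{FF}$ having blocks $\Sigma_{qq|vC}$ and $\Pi_{q|v.C}$, $$H_{uu}=D_{uu},\quad H_{uv}=D_{uv}+D_{uq}\Pi_{q|v.C},\quad W_{uu}=\Delta_{uu}+D_{up}\Delta_{pp}D_{up}^T+D_{uq}\Sigma_{qq|vC}D_{uq}^T .$$ The dependence of $Y_i$ on $Y_k$ in the MAG (maximal ancestral graph) model on $V\setminus(C\cup M)$ is the coefficient $\beta_{ik}$ of $Y_k$ in the linear least-squares regression of $Y_i$ on $Y_{c_i},Y_v,Y_C$. **Corollary (lack of confounding in measures of conditional dependence).** Let $i\leftarrow k$ be an arrow of $G$ with $i\in u$ and $k\in u\cup v$. 1. If $G$ has no active $ik$-path relative to $[C,M]$ other than the arrow $i\leftarrow k$, then the generating dependence is free of direct confounding: in the summary graph the pair $i,k$ has no double edge, the arrow $i\leftarrow k$ is not also induced by marginalising and conditioning (no $p$-line path in $\mathcal A$ joins $i$ to $k$ and, if $k\in v$, $(\mathcal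 D_{iq}\mathcal Z_{qk})=0$), $H_{ik}=A_{ik}$, and $W_{ik}=0$ if $k\in u$. 2. If the summary graph has no active $ik$-path relative to $[c_i,m_i]$ other than the arrow $i\leftarrow k$, then the dependence is free of indirect confounding: $\mathcal W_{ic}\mathcal W_{cc}^{-}\mathcal H_{ck}=0$ for $c=c_i$, where $\mathcal W_{cc}^-$ is the reflexive transitive closure of $\mathcal W_{cc}$ (conditioning on $Y_{c_i}$ induces no further $ik$-edge), and $\beta_{ik}=-H_{ik}$. 3. If both conditions hold, the generating dependence is undistorted in the MAG model: $\beta_{ik}=-A_{ik}$. -/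

import Mathlib

open MeasureTheory ProbabilityTheory

/-! ## Graphs with arrows, dashed lines and full lines, and their active paths -/

/-- A graph with three kinds of edges: `arrow i k` is `i ← k` (so `k` is a parent of `i`),
`dashed i k` is an edge `i - - k` of a covariance graph, `full i k` is an edge `i — k` of a
concentration graph.  Several kinds of edges may couple the same pair. -/
structure MixedGraph (V : Type) where
  arrow : V → V → Prop
  dashed : V → V → Prop
  full : V → V → Prop

/-- The four ways in which an edge can be traversed from its first to its second node. -/
inductive EdgeKind where
  | left
  | right
  | dashed
  | full

namespace EdgeKind

/-- The edge has an arrowhead, or the end of a dashed line, at its first node. -/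
def meetsFirst : EdgeKind → Prop
  | left => True
  | right => False
  | dashed => True
  | full => False

/-- The edge has an arrowhead, or the end of a dashed line, at its second node. -/
def meetsSecond : EdgeKind → Prop
  | left => False
  | right => True
  | dashed => True
  | full => False

end EdgeKind

namespace MixedGraph

variable {V : Type}

/-- The nodes `a`, `b` are coupled by an edge of the given kind: `a ← b`, `a → b`, `a - - b`
or `a — b`. -/
def HasEdge (G : MixedGraph V) (a : V) : EdgeKind → V → Prop
  | .left, b => G.arrow a b
  | .right, b => G.arrow b a
  | .dashed, b => G.dashed a b
  | .full, b => G.full a b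

/-- `k` is an ancestor of `i` (and `i` a descendant of `k`): there is a path of arrows
`i ← ⋯ ← k`. -/
def Ancestor (G : MixedGraph V) (i k : V) : Prop :=
  Relation.TransGen G.arrow i k

/-- The nodes `x 0, …, x n` are distinct, `n` is positive, and `e j` is an edge that couples
`x j` with `x (j + 1)`. -/
def IsPath (G : MixedGraph V) (n : ℕ) (x : ℕ → V) (e : ℕ → EdgeKind) : Prop :=
  0 < n ∧ (∀ j < n, G.HasEdge (x j) (e j) (x (j + 1))) ∧ Set.InjOn x (Set.Iic n)

/-- The inner node `x (j + 1)` is a collision node: both neighbouring edges of the path have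
an arrowhead or the end of a dashed line there.  Otherwise it is a transmitting node. -/
def IsCollision (e : ℕ → EdgeKind) (j : ℕ) : Prop :=
  (e j).meetsSecond ∧ (e (j + 1)).meetsFirst

/-- The path is active relative to `[c, m]`: every inner transmitting node is in `m`, and every
inner collision node is in `c` or has a descendant in `c`.  A single edge is always active. -/
def IsActive (G : MixedGraph V) (c m : Set V) (n : ℕ) (x : ℕ → V) (e : ℕ → EdgeKind) : Prop :=
  ∀ j, j + 1 < n →
    (IsCollision e j → x (j + 1) ∈ c ∨ ∃ t ∈ c, G.Ancestor t (x (j + 1))) ∧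
    (¬ IsCollision e j → x (j + 1) ∈ m)

/-- There is an `ik`-path that is active relative to `[c, m]`, apart from the path that consists
of the single arrow `i ← k`. -/
def HasActivePathBesidesArrow (G : MixedGraph V) (c m : Set V) (i k : V) : Prop :=
  ∃ (n : ℕ) (x : ℕ → V) (e : ℕ → EdgeKind),
    x 0 = i ∧ x n = k ∧ G.IsPath n x e ∧ G.IsActive c m n x e ∧
      ¬ (n = 1 ∧ e 0 = EdgeKind.left)

end MixedGraph

/-! ## Partial closure of edge matrices and partial inversion of parameter matrices -/

/-- For a binary edge matrix `F` (as a relation), the positions `(i, k)` for which `F` has an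
`a`-line path `i, s, …, t, k`, with inner nodes `s, …, t` in `a`. -/
def LinePath {V : Type} (a : Set V) (F : V → V → Prop) (i k : V) : Prop :=
  ∃ s ∈ a, ∃ t ∈ a,
    F i s ∧ Relation.ReflTransGen (fun x y => x ∈ a ∧ y ∈ a ∧ F x y) s t ∧ F t k

/-- Partial closure `zer_a F`: all `a`-line paths are closed. -/
def partialClosure {V : Type} (a : Set V) (F : V → V → Prop) (i k : V) : Prop :=
  F i k ∨ LinePath a F i k

section PartialInversion

variable {V : Type} [Fintype V] [DecidableEq V]

open Classical in
/-- The inverse of the principal submatrix `F_aa`, extended by zeros. -/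
noncomputable def blockInv (a : Set V) (F : Matrix V V ℝ) : Matrix V V ℝ :=
  fun i k =>
    if h : i ∈ a ∧ k ∈ a then
      ((F.submatrix (Subtype.val : a → V) (Subtype.val : a → V))⁻¹) ⟨i, h.1⟩ ⟨k, h.2⟩
    else 0

open Classical in
/-- Partial inversion `inv_a F`, with blocks (for `b` the complement of `a`)
`F_aa⁻¹`, `-F_aa⁻¹ F_ab`, `F_ba F_aa⁻¹` and `F_bb - F_ba F_aa⁻¹ F_ab`. -/
noncomputable def partialInv (a : Set V) (F : Matrix V V ℝ) : Matrix V V ℝ :=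
  fun i k =>
    if i ∈ a then
      if k ∈ a then blockInv a F i k else -(blockInv a F * F) i k
    else
      if k ∈ a then (F * blockInv a F) i k else (F - F * blockInv a F * F) i k

end PartialInversion

/-! ## Parent graphs and their summary graphs -/

/-- A directed acyclic graph on `V = {0, …, d - 1}` with a compatible ordering of its nodes:
the parents `k` of `i` (`arrow i k`, that is `i ← k`) come after `i`.  Connectedness is not
required. -/
structure ParentGraph (d : ℕ) where
  arrow : Fin d → Fin d → Prop
  lt_of_arrow : ∀ i k, arrow i k → i < k

namespace ParentGraph

variable {d : ℕ} (G : ParentGraph d) (C M : Set (Fin d))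

/-- The parent graph as a graph all of whose edges are arrows. -/
def toMixed : MixedGraph (Fin d) where
  arrow := G.arrow
  dashed _ _ := False
  full _ _ := False

/-- `F`: the ancestors of `C` outside `C`. -/
def foster : Set (Fin d) := {j | j ∉ C ∧ ∃ t ∈ C, G.toMixed.Ancestor t j}

/-- `R = C ∪ F`. -/
def right : Set (Fin d) := C ∪ G.foster C

/-- `O = V \ R`. -/
def outsiders : Set (Fin d) := (G.right C)ᶜ

/-- `u = O \ M`. -/
def u : Set (Fin d) := G.outsiders C \ M

/-- `v = F \ M`. -/
def v : Set (Fin d) := G.foster C \ M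

/-- `p = O ∩ M`. -/
def p : Set (Fin d) := G.outsiders C ∩ M

/-- `q = F ∩ M`. -/
def q : Set (Fin d) := G.foster C ∩ M

/-- The edge matrix of the parent graph, with ones along the diagonal. -/
def edgeA (i k : Fin d) : Prop := i = k ∨ G.arrow i k

/-- The edge matrix `zer_p A`. -/
def edgeD : Fin d → Fin d → Prop := partialClosure (G.p C M) G.edgeA

/-- The edge matrix `A_RRᵀ A_RR` of the concentration graph of `Y_F` given `Y_C`. -/
def edgeConc (r s : Fin d) : Prop := ∃ t ∈ G.right C, G.edgeA t r ∧ G.edgeA t s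

/-- Its partial closure on `q`; the blocks `(q,q)`, `(q,v)` and `(v,v)` are those for
`cov(Y_q | Y_v, Y_C)`, for the regression of `Y_q` on `Y_v` given `Y_C`, and for the
concentration graph of `Y_v` given `Y_C`. -/
def edgeZ : Fin d → Fin d → Prop := partialClosure (G.q C M) (G.edgeConc C)

/-- An arrow `i ← k` of the summary graph (`i ∈ u`) is induced by marginalising and
conditioning: by closing a `p`-line path of arrows or, for `k ∈ v`, through nodes of `q`. -/
def InducedArrow (i k : Fin d) : Prop :=
  LinePath (G.p C M) G.edgeA i k ∨
    (k ∈ G.v C M ∧ ∃ s ∈ G.q C M, G.edgeD C M i s ∧ G.edgeZ C M s k)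

/-- The edge matrices `H_uu` (equal to `zer_p A`) and `H_uv`, for `i ∈ u` and `k ∈ u ∪ v`. -/
def edgeH (i k : Fin d) : Prop := G.edgeA i k ∨ G.InducedArrow C M i k

/-- The edge matrix `W_uu`, for `i, k ∈ u`. -/
def edgeW (i k : Fin d) : Prop :=
  i = k ∨ (∃ s ∈ G.p C M, G.edgeD C M i s ∧ G.edgeD C M k s) ∨
    ∃ s ∈ G.q C M, ∃ t ∈ G.q C M, G.edgeD C M i s ∧ G.edgeZ C M s t ∧ G.edgeD C M k t

/-- The summary graph in the node set `u ∪ v = V \ (C ∪ M)`, obtained from the parent graph by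
conditioning on `C` and marginalising over `M`. -/
def summary : MixedGraph (Fin d) where
  arrow i k := i ≠ k ∧ i ∈ G.u C M ∧ (k ∈ G.u C M ∨ k ∈ G.v C M) ∧ G.edgeH C M i k
  dashed i k := i ≠ k ∧ i ∈ G.u C M ∧ k ∈ G.u C M ∧ G.edgeW C M i k
  full i k := i ≠ k ∧ i ∈ G.v C M ∧ k ∈ G.v C M ∧ G.edgeZ C M i k

/-- `c_i`: the ancestors of `i` within `u`. -/
def anc (i : Fin d) : Set (Fin d) := {k | k ∈ G.u C M ∧ G.toMixed.Ancestor i k}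

/-- `m_i`: the nodes of `u` up to `i`, and the nodes of `u` in the past of `i` that are not in
`c_i`. -/
def marg (i : Fin d) : Set (Fin d) :=
  {j | j ∈ G.u C M ∧ j ≤ i} ∪ {j | j ∈ G.u C M ∧ i < j ∧ j ∉ G.anc C M i}

/-! ## Linear triangular systems and the parameters of the three models -/

/-- A linear triangular system generated over the parent graph: `Y` is a mean-centred
square-integrable random vector with `A Y = ε`, where `A` has unit diagonal and `A i k = 0` for
`i ≠ k` unless `i ← k`, and the residuals `ε` are uncorrelated with positive variances `Δ`.
Gaussian triangular systems are those for which moreover `Y` is Gaussian.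
The generating dependence of `Y_i` on `Y_k` is the coefficient `-A i k`. -/
structure IsLinearTriangularSystem {Ω : Type*} [MeasurableSpace Ω] (μ : Measure Ω)
    (A : Matrix (Fin d) (Fin d) ℝ) (Δ : Fin d → ℝ) (Y : Fin d → Ω → ℝ) : Prop where
  diag : ∀ i, A i i = 1
  zero : ∀ i k, i ≠ k → ¬ G.arrow i k → A i k = 0
  pos : ∀ i, 0 < Δ i
  memLp : ∀ i, MemLp (Y i) 2 μ
  mean : ∀ i, ∫ ω, Y i ω ∂μ = 0
  resid : ∀ i k, cov[fun ω => ∑ j, A i j * Y j ω, fun ω => ∑ j, A k j * Y j ω; μ] =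
    if i = k then Δ i else 0

section Parameters

variable (A : Matrix (Fin d) (Fin d) ℝ) (Δ : Fin d → ℝ)

/-- `D = inv_p A`. -/
noncomputable def paramD : Matrix (Fin d) (Fin d) ℝ := partialInv (G.p C M) A

open Classical in
/-- `A_RRᵀ Δ_RR⁻¹ A_RR`, the concentration matrix of `Y_R`; its block `(F, F)` is the
concentration matrix of `Y_F` given `Y_C`. -/
noncomputable def paramConc : Matrix (Fin d) (Fin d) ℝ :=
  fun r s => ∑ t, if t ∈ G.right C then A t r * (Δ t)⁻¹ * A t s else 0

/-- Its partial inversion on `q`; the blocks `(q,q)` and `(q,v)` are `cov(Y_q | Y_v, Y_C)` and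
the coefficient matrix of `Y_v` in the regression of `Y_q` on `Y_v` and `Y_C`. -/
noncomputable def paramQ : Matrix (Fin d) (Fin d) ℝ :=
  partialInv (G.q C M) (G.paramConc C A Δ)

open Classical in
/-- The equation parameters of the summary graph model,
`H_uu Y_u + H_uv Y_v = η_u` given `Y_C`: `H_uu = D_uu` and
`H_uv = D_uv + D_uq Π_{q|v.C}`. -/
noncomputable def paramH : Matrix (Fin d) (Fin d) ℝ :=
  fun i k =>
    if k ∈ G.v C M then
      G.paramD C M A i k + ∑ s, if s ∈ G.q C M then G.paramD C M A i s * G.paramQ C M A Δ s k else 0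
    else G.paramD C M A i k

open Classical in
/-- The residual covariance matrix of the summary graph model,
`W_uu = Δ_uu + D_up Δ_pp D_upᵀ + D_uq Σ_{qq|vC} D_uqᵀ`. -/
noncomputable def paramW : Matrix (Fin d) (Fin d) ℝ :=
  fun i k =>
    (if i = k then Δ i else 0)
      + (∑ s, if s ∈ G.p C M then G.paramD C M A i s * Δ s * G.paramD C M A k s else 0)
      + ∑ s, ∑ t, if s ∈ G.q C M ∧ t ∈ G.q C M then
          G.paramD C M A i s * G.paramQ C M A Δ s t * G.paramD C M A k t else 0

end Parameters

/-- The coefficient of `Y_k` in the linear least-squares regression of `Y_i` on `Y_b`, for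
`i ∉ b` and `k ∈ b`: the entry of `Σ_ib Σ_bb⁻¹`, where `Σ` is the covariance matrix of `Y`. -/
noncomputable def regressionCoef {Ω : Type*} [MeasurableSpace Ω] (μ : Measure Ω)
    (Y : Fin d → Ω → ℝ) (b : Set (Fin d)) (i k : Fin d) : ℝ :=
  partialInv b (Matrix.of fun r s => cov[Y r, Y s; μ]) i k

/-- The dependence of `Y_i` on `Y_k` in the MAG model in the nodes `V \ (C ∪ M)`: the coefficient
of `Y_k` in the regression of `Y_i` on `Y_{c_i}` and `Y_v`, given `Y_C`. -/
noncomputable def magDependence {Ω : Type*} [MeasurableSpace Ω] (μ : Measure Ω)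
    (Y : Fin d → Ω → ℝ) (i k : Fin d) : ℝ :=
  regressionCoef μ Y (G.anc C M i ∪ G.v C M ∪ C) i k

/-- The generating dependence `i ← k` is free of direct confounding.
In the summary graph the pair `i, k` has no double edge and the arrow `i ← k` is not also induced
by marginalising and conditioning; and the generating dependence is the one in the equation for
`Y_i` of the summary graph model, with residuals of `Y_i`, `Y_k` uncorrelated. -/
def FreeOfDirectConfounding (A : Matrix (Fin d) (Fin d) ℝ) (Δ : Fin d → ℝ) (i k : Fin d) : Prop :=
  (¬ (G.summary C M).dashed i k ∧ ¬ G.InducedArrow C M i k) ∧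
    G.paramH C M A Δ i k = A i k ∧ (k ∈ G.u C M → G.paramW C M A Δ i k = 0)

/-- The structural form of indirect confounding: the edge matrix product
`W_ic W_cc⁻ H_ck`, with `c = c_i`, of the summary graph is one, so that conditioning on `Y_{c_i}`
induces a further contribution to the arrow `i ← k` of the MAG. -/
def InducedByAncestors (i k : Fin d) : Prop :=
  ∃ j ∈ G.anc C M i, ∃ l ∈ G.anc C M i,
    G.edgeW C M i j ∧
      Relation.ReflTransGen
        (fun x y => x ∈ G.anc C M i ∧ y ∈ G.anc C M i ∧ G.edgeW C M x y) j l ∧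
      G.edgeH C M l k

/-- The dependence `i ← k` is free of indirect confounding: passing from the equation for `Y_i`
of the summary graph model to the regression of `Y_i` on `Y_{c_i}`, `Y_v` given `Y_C` of the MAG
model induces no further `ik`-edge and does not change the dependence of `Y_i` on `Y_k`. -/
def FreeOfIndirectConfounding {Ω : Type*} [MeasurableSpace Ω] (μ : Measure Ω)
    (A : Matrix (Fin d) (Fin d) ℝ) (Δ : Fin d → ℝ) (Y : Fin d → Ω → ℝ) (i k : Fin d) : Prop :=
  ¬ G.InducedByAncestors C M i k ∧
    G.magDependence C M μ Y i k = -G.paramH C M A Δ i k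

end ParentGraph
/-!
Walking along the arrows of `G` behind an induced edge between `i` and `k` — a `p`-line path, or two
such paths joined by a `zer_q`-path of the concentration graph — yields an active walk, because
every node of `R` is in `C` or has a descendant in `C`. An active walk along arrows and dashed lines
contains an active path: when a loop is cut out, a collision created at the cut has a descendant
that is a collision node of the loop. So without active paths no edge is induced, and the structural
zeros of the edge matrices are zeros of the parameter matrices, since inverting a block triangular
matrix preserves its zero blocks.

For the MAG model, `η_u = T Y` with `cov(η_u) = W_uu` and `η_u` uncorrelated with `Y_v` and `Y_C`.
The residual of the MAG regression of `Y_i` is `η_i` minus its regression on the `η_j` with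
`j ∈ c_i`, as one checks with the normal equations. Hence `-β_ik = H_ik - W_ic W_cc⁻¹ H_ck`, and the
last term vanishes if conditioning on `Y_{c_i}` induces no edge.
-/

open scoped Matrix

/-! ## From active walks to active paths -/

/-- The first `n` terms of `x`, followed by `y`; used to concatenate walks. -/
def splice {α : Type*} (n : ℕ) (x y : ℕ → α) (j : ℕ) : α := if j < n then x j else y (j - n)

section Splice

variable {α : Type*} {n j : ℕ} {x y : ℕ → α}

theorem splice_of_lt (h : j < n) : splice n x y j = x j := if_pos h

theorem splice_add (n j : ℕ) : splice n x y (n + j) = y j := by simp [splice]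

theorem splice_of_le (hxy : x n = y 0) (h : j ≤ n) : splice n x y j = x j := by
  rcases h.lt_or_eq with h | rfl
  · exact splice_of_lt h
  · rw [hxy]
    exact splice_add j 0

end Splice

theorem EdgeKind.eq_right_of_not_meetsFirst {e : EdgeKind} (hfull : e ≠ .full)
    (h : ¬ e.meetsFirst) : e = .right := by
  cases e <;> simp_all [EdgeKind.meetsFirst]

theorem EdgeKind.eq_left_of_not_meetsSecond {e : EdgeKind} (hfull : e ≠ .full)
    (h : ¬ e.meetsSecond) : e = .left := by
  cases e <;> simp_all [EdgeKind.meetsSecond]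

namespace MixedGraph

variable {V : Type} {G : MixedGraph V} {c m : Set V} {n : ℕ} {x : ℕ → V} {e : ℕ → EdgeKind}

/-- The condition that `IsActive` imposes at an inner node `s` between edges of kinds `e` and
`e'`. -/
def ActiveAt (G : MixedGraph V) (c m : Set V) (e : EdgeKind) (s : V) (e' : EdgeKind) : Prop :=
  (e.meetsSecond ∧ e'.meetsFirst → s ∈ c ∨ ∃ t ∈ c, G.Ancestor t s) ∧
    (¬ (e.meetsSecond ∧ e'.meetsFirst) → s ∈ m)

theorem activeAt_of_collision {s : V} {e e' : EdgeKind} (hs : s ∈ c ∨ ∃ t ∈ c, G.Ancestor t s)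
    (he : e.meetsSecond) (he' : e'.meetsFirst) : G.ActiveAt c m e s e' :=
  ⟨fun _ => hs, fun h => absurd ⟨he, he'⟩ h⟩

/-- A walk with `n` edges along arrows and dashed lines, active relative to `[c, m]`; nodes may be
repeated. Full lines are left out since an active walk with full lines need not contain an active
path: in `→ s — t — s ←` cutting the loop turns `s` into a collision node. -/
structure IsActiveWalk (G : MixedGraph V) (c m : Set V) (n : ℕ) (x : ℕ → V) (e : ℕ → EdgeKind) :
    Prop where
  hasEdge : ∀ j < n, G.HasEdge (x j) (e j) (x (j + 1))
  ne_full : ∀ j < n, e j ≠ .full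
  activeAt : ∀ j, j + 1 < n → G.ActiveAt c m (e j) (x (j + 1)) (e (j + 1))

namespace IsActiveWalk

theorem take (h : G.IsActiveWalk c m n x e) {a : ℕ} (ha : a ≤ n) : G.IsActiveWalk c m a x e where
  hasEdge j hj := h.hasEdge j (hj.trans_le ha)
  ne_full j hj := h.ne_full j (hj.trans_le ha)
  activeAt j hj := h.activeAt j (hj.trans_le ha)

theorem drop (h : G.IsActiveWalk c m n x e) (a : ℕ) :
    G.IsActiveWalk c m (n - a) (fun j => x (a + j)) (fun j => e (a + j)) where
  hasEdge j hj := h.hasEdge (a + j) (by omega)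
  ne_full j hj := h.ne_full (a + j) (by omega)
  activeAt j hj := h.activeAt (a + j) (by omega)

theorem single {s t : V} {f : EdgeKind} (hst : G.HasEdge s f t) (hf : f ≠ .full) :
    G.IsActiveWalk c m 1 (fun j => if j = 0 then s else t) (fun _ => f) where
  hasEdge j hj := by
    obtain rfl : j = 0 := by omega
    simpa using hst
  ne_full _ _ := hf
  activeAt _ hj := by omega

theorem append {n' : ℕ} {x' : ℕ → V} {e' : ℕ → EdgeKind} (h : G.IsActiveWalk c m n x e)
    (h' : G.IsActiveWalk c m n' x' e') (hx : x n = x' 0)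
    (hjoin : ∀ j, j + 1 = n → 0 < n' → G.ActiveAt c m (e j) (x n) (e' 0)) :
    G.IsActiveWalk c m (n + n') (splice n x x') (splice n e e') where
  hasEdge j hj := by
    rcases lt_or_ge j n with hjn | hnj
    · rw [splice_of_le hx hjn.le, splice_of_lt hjn, splice_of_le hx hjn]
      exact h.hasEdge j hjn
    · obtain ⟨l, rfl⟩ := Nat.exists_eq_add_of_le hnj
      rw [add_assoc, splice_add, splice_add, splice_add]
      exact h'.hasEdge l (by omega)
  ne_full j hj := by
    rcases lt_or_ge j n with hjn | hnj
    · rw [splice_of_lt hjn]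
      exact h.ne_full j hjn
    · obtain ⟨l, rfl⟩ := Nat.exists_eq_add_of_le hnj
      rw [splice_add]
      exact h'.ne_full l (by omega)
  activeAt j hj := by
    rcases lt_trichotomy (j + 1) n with hjn | hjn | hnj
    · rw [splice_of_lt hjn, splice_of_lt hjn, splice_of_lt (by omega)]
      exact h.activeAt j hjn
    · rw [splice_of_lt (by omega), splice_of_le hx hjn.le, hjn,
        show splice n e e' n = e' 0 from splice_add n 0]
      exact hjoin j hjn (by omega)
    · obtain ⟨l, rfl⟩ := Nat.exists_eq_add_of_le (Nat.le_of_lt_succ hnj)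
      rw [add_assoc, splice_add, splice_add, splice_add]
      exact h'.activeAt l (by omega)

/-- Following the arrows that leave `x a`, the first edge that is not of this kind makes a collision
node, which is a descendant of `x a`. -/
theorem exists_mem_ancestor (h : G.IsActiveWalk c m n x e) {a b : ℕ} (hab : a < b) (hbn : b < n)
    (ha : e a = .right) (hb : e b ≠ .right) : ∃ t ∈ c, G.Ancestor t (x a) := by
  have harrow : ∀ j < n, e j = .right → G.arrow (x (j + 1)) (x j) := fun j hj hej => by
    have hedge := h.hasEdge j hj
    rw [hej] at hedge
    exact hedge
  have hturn : ∀ a, a + 1 < n → e a = .right → e (a + 1) ≠ .right →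
      ∃ t ∈ c, G.Ancestor t (x a) := fun a han ha hnext => by
    have hcoll : (e a).meetsSecond ∧ (e (a + 1)).meetsFirst := ⟨by rw [ha]; trivial,
      by_contra fun hf => hnext (EdgeKind.eq_right_of_not_meetsFirst (h.ne_full _ han) hf)⟩
    rcases (h.activeAt a han).1 hcoll with hc | ⟨t, ht, hanc⟩
    · exact ⟨_, hc, .single (harrow a (by omega) ha)⟩
    · exact ⟨t, ht, hanc.tail (harrow a (by omega) ha)⟩
  obtain ⟨l, rfl⟩ := Nat.exists_eq_add_of_lt hab
  induction l generalizing a with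
  | zero => exact hturn a hbn ha hb
  | succ l ih =>
    by_cases hnext : e (a + 1) = .right
    · rw [show a + (l + 1) + 1 = a + 1 + l + 1 by omega] at hb hbn
      obtain ⟨t, ht, hanc⟩ := ih hnext (by omega) hbn hb
      exact ⟨t, ht, hanc.tail (harrow a (by omega) ha)⟩
    · exact hturn a (by omega) ha hnext

/-- If the cut at a transmitting node creates a collision, the loop leaves and enters the node along
arrows that point away from it, so that it contains a collision at a descendant of the node. -/
theorem activeAt_of_eq (h : G.IsActiveWalk c m n x e) {a b : ℕ} (hab : a < b) (hbn : b + 1 < n)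
    (hx : x (a + 1) = x (b + 1)) : G.ActiveAt c m (e a) (x (a + 1)) (e (b + 1)) := by
  have hA := h.activeAt a (by omega)
  have hB := h.activeAt b hbn
  rw [← hx] at hB
  refine ⟨fun hcoll => ?_, fun htrans => ?_⟩
  · by_cases hfirst : (e (a + 1)).meetsFirst
    · exact hA.1 ⟨hcoll.1, hfirst⟩
    by_cases hsecond : (e b).meetsSecond
    · exact hB.1 ⟨hsecond, hcoll.2⟩
    have hright : e (a + 1) = .right :=
      EdgeKind.eq_right_of_not_meetsFirst (h.ne_full _ (by omega)) hfirst
    have hleft : e b = .left :=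
      EdgeKind.eq_left_of_not_meetsSecond (h.ne_full _ (by omega)) hsecond
    have hlt : a + 1 < b :=
      lt_of_le_of_ne hab fun hEq => by simp [← hEq, hright] at hleft
    exact .inr (h.exists_mem_ancestor hlt (by omega) hright (by simp [hleft]))
  · by_cases hfirst : (e a).meetsSecond ∧ (e (a + 1)).meetsFirst
    · exact hB.2 fun hB' => htrans ⟨hfirst.1, hB'.2⟩
    · exact hA.2 hfirst

theorem cut (h : G.IsActiveWalk c m n x e) {a b : ℕ} (ha : 0 < a) (hab : a < b)
    (hbn : b ≤ n) (hx : x a = x b) :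
    G.IsActiveWalk c m (a + (n - b)) (splice a x fun j => x (b + j))
      (splice a e fun j => e (b + j)) := by
  refine (h.take (by omega)).append (h.drop b) hx fun j hj hn => ?_
  subst hj
  obtain ⟨b, rfl⟩ := Nat.exists_eq_add_of_lt (Nat.zero_lt_of_lt hab)
  rw [zero_add] at *
  exact h.activeAt_of_eq (by omega) (by omega) hx

theorem hasActivePathBesidesArrow (h : G.IsActiveWalk c m n x e) (hn : 0 < n)
    (hret : ∀ j, 0 < j → j ≤ n → x j ≠ x 0) (hne : ¬ (x 1 = x n ∧ e 0 = .left)) :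
    G.HasActivePathBesidesArrow c m (x 0) (x n) := by
  induction n using Nat.strong_induction_on generalizing x e with
  | _ n ih =>
    by_cases hinj : Set.InjOn x (Set.Iic n)
    · exact ⟨n, x, e, rfl, rfl, ⟨hn, h.hasEdge, hinj⟩, h.activeAt,
        fun harrow => hne ⟨by rw [harrow.1], harrow.2⟩⟩
    obtain ⟨a, b, hab, hbn, hx⟩ : ∃ a b, a < b ∧ b ≤ n ∧ x a = x b := by
      simp only [Set.InjOn, Set.mem_Iic] at hinj
      push Not at hinj
      obtain ⟨a, ha, b, hb, hx, hab⟩ := hinj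
      rcases hab.lt_or_gt with hab | hba
      exacts [⟨a, b, hab, hb, hx⟩, ⟨b, a, hba, ha, hx.symm⟩]
    have ha : 0 < a := Nat.pos_of_ne_zero fun ha =>
      hret b (by omega) hbn (by rw [← hx, ha])
    have hfst : ∀ {α : Type} {y z : ℕ → α}, splice a y z 0 = y 0 := splice_of_lt ha
    have hend : splice a x (fun j => x (b + j)) (a + (n - b)) = x n := by
      rw [splice_add, Nat.add_sub_cancel' hbn]
    have hcut := ih (a + (n - b)) (by omega) (h.cut ha hab hbn hx) (by omega) ?_ ?_
    · rwa [hend, hfst] at hcut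
    · intro j hj hjn
      rw [hfst]
      rcases lt_or_ge j a with hja | haj
      · rw [splice_of_lt hja]
        exact hret j hj (by omega)
      · obtain ⟨l, rfl⟩ := Nat.exists_eq_add_of_le haj
        rw [splice_add]
        exact hret (b + l) (by omega) (by omega)
    · rwa [hend, hfst, splice_of_le hx ha]

end IsActiveWalk

/-- The `s` and `e` for which an active walk without full lines that starts with `i`, `e₁`, `s₁` and
does not return to `i` can arrive at `s` by an edge of kind `e`. -/
inductive Reaches (G : MixedGraph V) (c m : Set V) (i s₁ : V) (e₁ : EdgeKind) :
    V → EdgeKind → Prop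
  | start (hfull : e₁ ≠ .full) (hedge : G.HasEdge i e₁ s₁) (hne : s₁ ≠ i) :
      Reaches G c m i s₁ e₁ s₁ e₁
  | step {s t : V} {e e' : EdgeKind} (hs : Reaches G c m i s₁ e₁ s e)
      (hact : G.ActiveAt c m e s e') (hfull : e' ≠ .full) (hedge : G.HasEdge s e' t)
      (hne : t ≠ i) : Reaches G c m i s₁ e₁ t e'

namespace Reaches

variable {i s₁ s k : V} {e₁ e' : EdgeKind}

theorem exists_isActiveWalk (h : G.Reaches c m i s₁ e₁ s e') :
    ∃ (n : ℕ) (x : ℕ → V) (f : ℕ → EdgeKind), G.IsActiveWalk c m (n + 1) x f ∧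
      x 0 = i ∧ x 1 = s₁ ∧ f 0 = e₁ ∧ x (n + 1) = s ∧ f n = e' ∧ ∀ j ≤ n, x (j + 1) ≠ i := by
  induction h with
  | start hfull hedge hne =>
    exact ⟨0, _, _, .single hedge hfull, rfl, rfl, rfl, rfl, rfl, fun _ _ => hne⟩
  | @step s t e e' _ hact hfull hedge hne ih =>
    obtain ⟨n, x, f, hw, hx0, hx1, hf0, hxn, hfn, hret⟩ := ih
    refine ⟨n + 1, splice (n + 1) x fun j => if j = 0 then s else t,
      splice (n + 1) f fun _ => e', hw.append (.single hedge hfull) (by simpa using hxn) ?_, ?_⟩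
    · intro j hj _
      obtain rfl : j = n := by omega
      rwa [hfn, hxn]
    have hle : ∀ j ≤ n + 1, splice (n + 1) x (fun j => if j = 0 then s else t) j = x j :=
      fun j hj => splice_of_le (by simpa using hxn) hj
    refine ⟨by rw [hle 0 (by omega), hx0], by rw [hle 1 (by omega), hx1],
      by rw [splice_of_lt (by omega), hf0], splice_add _ 1, splice_add _ 0, fun j hj => ?_⟩
    rcases hj.lt_or_eq with hj | rfl
    · rw [hle (j + 1) (by omega)]
      exact hret j (by omega)
    · rw [splice_add]
      exact hne

theorem hasActivePathBesidesArrow (h : G.Reaches c m i s₁ e₁ k e')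
    (hne : ¬ (s₁ = k ∧ e₁ = .left)) : G.HasActivePathBesidesArrow c m i k := by
  obtain ⟨n, x, f, hw, rfl, rfl, rfl, rfl, -, hret⟩ := h.exists_isActiveWalk
  refine hw.hasActivePathBesidesArrow n.succ_pos (fun j hj hjn => ?_) hne
  obtain ⟨j, rfl⟩ := Nat.exists_eq_add_of_lt hj
  exact hret _ (by omega)

end Reaches
end MixedGraph

/-! ## Partial closure -/

section PartialClosure

variable {V : Type} {a : Set V} {F : V → V → Prop} {i k : V}

theorem partialClosure.induction_on {P : V → Prop} (h : partialClosure a F i k) (hi : P i)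
    (step : ∀ s t, s ∈ insert i a → t ∈ insert k a → P s → F s t → P t) : P k := by
  rcases h with h | ⟨s, hs, t, ht, his, hst, htk⟩
  · exact step i k (.inl rfl) (.inl rfl) hi h
  refine step t k (.inr ht) (.inl rfl) ?_ htk
  clear htk
  induction hst with
  | refl => exact step i s (.inl rfl) (.inr hs) hi his
  | tail _ h ih => exact step _ _ (.inr h.1) (.inr h.2.1) (ih h.1) h.2.2

theorem LinePath.exists_partialClosure (h : LinePath a F i k) :
    ∃ t ∈ a, partialClosure a F i t ∧ F t k := by
  obtain ⟨s, hs, t, ht, his, hst, htk⟩ := h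
  refine ⟨t, ht, ?_, htk⟩
  rcases hst.cases_tail with rfl | ⟨r, hsr, hrt⟩
  · exact .inl his
  · exact .inr ⟨s, hs, r, hrt.1, his, hsr, hrt.2.2⟩

end PartialClosure

/-! ## Induced edges and active paths -/

namespace ParentGraph

variable {d : ℕ} {G : ParentGraph d} {C M : Set (Fin d)}

theorem lt_of_ancestor {i k : Fin d} (h : G.toMixed.Ancestor i k) : i < k := by
  induction h with
  | single h => exact G.lt_of_arrow _ _ h
  | tail _ h ih => exact ih.trans (G.lt_of_arrow _ _ h)

theorem mem_right_iff {j : Fin d} :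
    j ∈ G.right C ↔ j ∈ C ∨ ∃ t ∈ C, G.toMixed.Ancestor t j := by
  simp only [right, foster, Set.mem_union, Set.mem_ofPred_eq]
  tauto

theorem mem_right_of_arrow {r t : Fin d} (hr : r ∈ G.right C) (h : G.arrow r t) :
    t ∈ G.right C := by
  rw [mem_right_iff] at hr ⊢
  rcases hr with hr | ⟨s, hs, hsr⟩
  · exact .inr ⟨r, hr, .single h⟩
  · exact .inr ⟨s, hs, hsr.tail h⟩

theorem q_subset_right : G.q C M ⊆ G.right C := fun _ h => .inr h.1

theorem v_subset_right : G.v C M ⊆ G.right C := fun _ h => .inr h.1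

theorem mem_u_or_mem_v {k : Fin d} (hk : k ∉ C ∪ M) : k ∈ G.u C M ∨ k ∈ G.v C M := by
  simp only [Set.mem_union, not_or] at hk
  by_cases h : k ∈ G.foster C
  · exact .inr ⟨h, hk.2⟩
  · exact .inl ⟨fun h' => h'.elim hk.1 h, hk.2⟩

theorem edgeConc_refl {r : Fin d} (h : r ∈ G.right C) : G.edgeConc C r r :=
  ⟨r, h, .inl rfl, .inl rfl⟩

theorem eq_or_ancestor_of_edgeD {i k : Fin d} (h : G.edgeD C M i k) :
    i = k ∨ G.toMixed.Ancestor i k := by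
  refine partialClosure.induction_on (P := fun t => i = t ∨ G.toMixed.Ancestor i t) h (.inl rfl) ?_
  rintro s t - - his (rfl | hst)
  · exact his
  · rcases his with rfl | his
    · exact .inr (.single hst)
    · exact .inr (his.tail hst)

section ActivePaths

variable {i s₁ s k : Fin d} {e₁ e : EdgeKind}

theorem activeAt_of_mem_q (hs : s ∈ G.q C M) (e e' : EdgeKind) :
    G.toMixed.ActiveAt C M e s e' :=
  ⟨fun _ => mem_right_iff.1 (q_subset_right hs), fun _ => hs.2⟩

theorem exists_reaches_of_edgeD (hi : i ∉ M) (hs : s ∈ M) (h : G.edgeD C M i s) :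
    ∃ s₁ ∈ M, G.toMixed.Reaches C M i s₁ .left s .left := by
  refine partialClosure.induction_on h
    (P := fun t => t ∈ M → ∃ s₁ ∈ M, G.toMixed.Reaches C M i s₁ .left t .left)
    (fun h => absurd h hi) ?_ hs
  rintro s t hs' - hreach (rfl | hst) ht
  · exact hreach ht
  have hti : t ≠ i := fun h => hi (h ▸ ht)
  rcases hs' with rfl | hs'
  · exact ⟨t, ht, .start nofun hst hti⟩
  · obtain ⟨s₁, hs₁, hr⟩ := hreach hs'.2
    exact ⟨s₁, hs₁, hr.step ⟨fun h => h.1.elim, fun _ => hs'.2⟩ nofun hst hti⟩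

theorem exists_reaches_of_edgeD_left (hi : i ∉ M) (hs : s ∈ M) (hk : k ≠ i)
    (h : G.edgeD C M k s) (hr : G.toMixed.Reaches C M i s₁ e₁ s e) :
    ∃ e', G.toMixed.Reaches C M i s₁ e₁ k e' := by
  refine partialClosure.induction_on h
    (P := fun t => ∀ e, G.toMixed.Reaches C M i s₁ e₁ t e →
      ∃ e', G.toMixed.Reaches C M i s₁ e₁ k e')
    (fun e hr => ⟨e, hr⟩) ?_ e hr
  rintro x y hx hy hreach (rfl | hxy) e hr
  · exact hreach e hr
  have hyM : y ∈ M := by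
    rcases hy with rfl | hy
    exacts [hs, hy.2]
  have hxi : x ≠ i := by
    rcases hx with rfl | hx
    exacts [hk, fun h => hi (h ▸ hx.2)]
  exact hreach .right (hr.step ⟨fun h => h.2.elim, fun _ => hyM⟩ nofun hxy hxi)

theorem exists_reaches_of_edgeConc (hi : i ∈ G.u C M) (hs : s ∈ G.q C M) (hk : k ≠ i)
    (h : G.edgeConc C s k) (hr : G.toMixed.Reaches C M i s₁ e₁ s e) :
    ∃ e', G.toMixed.Reaches C M i s₁ e₁ k e' := by
  obtain ⟨t, ht, hts, htk⟩ := h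
  have hti : t ≠ i := fun h => hi.1 (h ▸ ht)
  rcases hts with rfl | hts <;> rcases htk with rfl | htk
  · exact ⟨e, hr⟩
  · exact ⟨.left, hr.step (activeAt_of_mem_q hs _ _) nofun htk hk⟩
  · exact ⟨.right, hr.step (activeAt_of_mem_q hs _ _) nofun hts hti⟩
  · have hr' : G.toMixed.Reaches C M i s₁ e₁ t .right :=
      hr.step (activeAt_of_mem_q hs _ _) nofun hts hti
    exact ⟨.left, hr'.step (MixedGraph.activeAt_of_collision (mem_right_iff.1 ht) trivial trivial)
      nofun htk hk⟩

theorem exists_reaches_of_edgeZ (hi : i ∈ G.u C M) (hs : s ∈ G.q C M) (hk : k ≠ i)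
    (h : G.edgeZ C M s k) (hr : G.toMixed.Reaches C M i s₁ e₁ s e) :
    ∃ e', G.toMixed.Reaches C M i s₁ e₁ k e' := by
  refine partialClosure.induction_on (P := fun t => ∃ e', G.toMixed.Reaches C M i s₁ e₁ t e') h
    ⟨e, hr⟩ ?_
  rintro x y hx hy ⟨e', hr'⟩ hxy
  have hxq : x ∈ G.q C M := by
    rcases hx with rfl | hx
    exacts [hs, hx]
  have hyi : y ≠ i := by
    rcases hy with rfl | hy
    exacts [hk, fun h => hi.2 (h ▸ hy.2)]
  exact exists_reaches_of_edgeConc hi hxq hyi hxy hr'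

theorem hasActivePath_of_inducedArrow (hi : i ∈ G.u C M) (hik : k ≠ i) (hk : k ∉ M)
    (h : G.InducedArrow C M i k) : G.toMixed.HasActivePathBesidesArrow C M i k := by
  rcases h with h | ⟨-, s, hs, his, hsk⟩
  · obtain ⟨t, ht, hit, htk⟩ := h.exists_partialClosure
    obtain ⟨s₁, hs₁, hr⟩ := exists_reaches_of_edgeD hi.2 ht.2 hit
    have htk : G.arrow t k := htk.resolve_left fun h => hk (h ▸ ht.2)
    have hr' := hr.step ⟨fun h => h.1.elim, fun _ => ht.2⟩ (e' := .left) nofun htk hik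
    exact hr'.hasActivePathBesidesArrow fun h => hk (h.1 ▸ hs₁)
  · obtain ⟨s₁, hs₁, hr⟩ := exists_reaches_of_edgeD hi.2 hs.2 his
    obtain ⟨e, hr'⟩ := exists_reaches_of_edgeZ hi hs hik hsk hr
    exact hr'.hasActivePathBesidesArrow fun h => hk (h.1 ▸ hs₁)

theorem hasActivePath_of_edgeW (hi : i ∈ G.u C M) (hik : k ≠ i) (hk : k ∉ M)
    (h : G.edgeW C M i k) : G.toMixed.HasActivePathBesidesArrow C M i k := by
  obtain ⟨s, t, ht, hs, his, hkt, hst⟩ : ∃ s t, t ∈ M ∧ s ∈ M ∧ G.edgeD C M i s ∧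
      G.edgeD C M k t ∧ (s = t ∨ s ∈ G.q C M ∧ G.edgeZ C M s t) := by
    rcases h with h | ⟨s, hs, his, hks⟩ | ⟨s, hs, t, ht, his, hst, hkt⟩
    · exact absurd h.symm hik
    · exact ⟨s, s, hs.2, hs.2, his, hks, .inl rfl⟩
    · exact ⟨s, t, ht.2, hs.2, his, hkt, .inr ⟨hs, hst⟩⟩
  obtain ⟨s₁, hs₁, hr⟩ := exists_reaches_of_edgeD hi.2 hs his
  obtain ⟨e, hr⟩ : ∃ e, G.toMixed.Reaches C M i s₁ .left t e := by
    rcases hst with rfl | ⟨hs, hst⟩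
    · exact ⟨_, hr⟩
    · exact exists_reaches_of_edgeZ hi hs (fun h => hi.2 (h ▸ ht)) hst hr
  obtain ⟨e', hr'⟩ := exists_reaches_of_edgeD_left hi.2 ht hik hkt hr
  exact hr'.hasActivePathBesidesArrow fun h => hk (h.1 ▸ hs₁)

theorem ne_of_mem_anc (h : k ∈ G.anc C M i) : k ≠ i := (lt_of_ancestor h.2).ne'

theorem hasActivePath_of_inducedByAncestors (hi : i ∈ G.u C M) (hik : k ≠ i)
    (hk : k ∈ G.u C M ∨ k ∈ G.v C M) (h : G.InducedByAncestors C M i k) :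
    (G.summary C M).HasActivePathBesidesArrow (G.anc C M i) (G.marg C M i) i k := by
  obtain ⟨j, hj, l, hl, hij, hjl, hlk⟩ := h
  have hr : (G.summary C M).Reaches (G.anc C M i) (G.marg C M i) i j .dashed l .dashed := by
    clear hlk
    induction hjl with
    | refl => exact .start nofun ⟨(ne_of_mem_anc hj).symm, hi, hj.1, hij⟩ (ne_of_mem_anc hj)
    | @tail x y _ h ih =>
      rcases eq_or_ne x y with rfl | hxy
      · exact ih h.1
      · exact (ih h.1).step (MixedGraph.activeAt_of_collision (.inl h.1) trivial trivial) nofun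
          ⟨hxy, h.1.1, h.2.1.1, h.2.2⟩ (ne_of_mem_anc hl)
  rcases eq_or_ne l k with rfl | hlk'
  · exact hr.hasActivePathBesidesArrow nofun
  · have hr' := hr.step (e' := .left)
      (MixedGraph.activeAt_of_collision (.inl hl) trivial trivial) nofun ⟨hlk', hl.1, hk, hlk⟩ hik
    exact hr'.hasActivePathBesidesArrow nofun

end ActivePaths
end ParentGraph

/-! ## Partial inversion -/

section MatrixEntries

variable {V R : Type*} [Fintype V] [NonUnitalNonAssocSemiring R] {i k : V}

theorem exists_ne_zero_of_mul_apply_ne_zero {M N : Matrix V V R}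
    (h : (M * N) i k ≠ 0) : ∃ j, M i j ≠ 0 ∧ N j k ≠ 0 := by
  obtain ⟨j, -, hj⟩ := Finset.exists_ne_zero_of_sum_ne_zero h
  exact ⟨j, left_ne_zero_of_mul hj, right_ne_zero_of_mul hj⟩

theorem mul_apply_eq_zero_of_row {M N : Matrix V V R} (h : ∀ j, M i j = 0) :
    (M * N) i k = 0 :=
  Finset.sum_eq_zero fun j _ => mul_eq_zero_of_left (h j) _

theorem mul_apply_eq_zero_of_col {M N : Matrix V V R} (h : ∀ j, N j k = 0) :
    (M * N) i k = 0 :=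
  Finset.sum_eq_zero fun j _ => mul_eq_zero_of_right _ (h j)

theorem mul_apply_congr_col {M N N' : Matrix V V R} (h : ∀ j, N j k = N' j k) :
    (M * N) i k = (M * N') i k :=
  Finset.sum_congr rfl fun j _ => congrArg (M i j * ·) (h j)

end MatrixEntries

theorem eq_zero_of_unitriangular_mulVec {V R : Type*} [Fintype V] [LinearOrder V]
    [NonAssocSemiring R] {F : Matrix V V R} {S : Set V} {f : V → R}
    (hdiag : ∀ r ∈ S, F r r = 1)
    (htri : ∀ r ∈ S, ∀ j, j ≠ r → F r j ≠ 0 → f j = 0 ∨ j ∈ S ∧ r < j)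
    (hzero : ∀ r ∈ S, (F *ᵥ f) r = 0) : ∀ r ∈ S, f r = 0 := by
  intro r
  induction r using WellFoundedGT.induction with
  | _ r ih =>
    intro hr
    have hsum : (F *ᵥ f) r = F r r * f r := by
      refine Finset.sum_eq_single r (fun j _ hj => ?_) (by simp)
      by_cases hrj : F r j = 0
      · exact mul_eq_zero_of_left hrj _
      · rcases htri r hr j hj hrj with h | ⟨h, hlt⟩
        · exact mul_eq_zero_of_right _ h
        · exact mul_eq_zero_of_right _ (ih j hlt h)
    rw [← hzero r hr, hsum, hdiag r hr, one_mul]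

section PartialInversion

variable {V : Type} [Fintype V] [DecidableEq V] {a : Set V} {F : Matrix V V ℝ}

open Classical in
/-- The principal submatrix `F_aa` is nonsingular; otherwise `blockInv a F` and `partialInv a F`
have junk values. -/
def IsRegularOn (a : Set V) (F : Matrix V V ℝ) : Prop :=
  IsUnit (F.submatrix (Subtype.val : a → V) (Subtype.val : a → V)).det

theorem isRegularOn_of_mulVec_eq_zero_imp
    (h : ∀ x : V → ℝ, (∀ i ∉ a, x i = 0) → (∀ i ∈ a, (F *ᵥ x) i = 0) → ∀ i ∈ a, x i = 0) :
    IsRegularOn a F := by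
  classical
  rw [IsRegularOn, isUnit_iff_ne_zero]
  intro hdet
  obtain ⟨w, hw, hw0⟩ := Matrix.exists_mulVec_eq_zero_iff.2 hdet
  let x : V → ℝ := fun j => if hj : j ∈ a then w ⟨j, hj⟩ else 0
  have hxw : ∀ j (hj : j ∈ a), x j = w ⟨j, hj⟩ := fun j hj => dif_pos hj
  have hFx : ∀ i ∈ a, (F *ᵥ x) i = 0 := fun i hi => by
    refine Eq.trans ?_ (congrFun hw0 ⟨i, hi⟩)
    exact Finset.sum_congr_set a _ (fun j => F i j * w j) (fun j hj => by rw [hxw j hj])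
      (fun j hj => by simp [x, hj])
  exact hw (funext fun i => by
    rw [← hxw i i.2]
    exact h x (fun i hi => dif_neg hi) hFx i i.2)

theorem isRegularOn_of_posDef (hF : F.PosDef) : IsRegularOn a F := by
  classical
  exact (hF.submatrix Subtype.val_injective).det_pos.ne'.isUnit

theorem IsRegularOn.transpose (h : IsRegularOn a F) : IsRegularOn a F.transpose := by
  classical
  rw [IsRegularOn, ← Matrix.transpose_submatrix, Matrix.det_transpose]
  exact h

variable {i k : V}

theorem blockInv_of_notMem_left (hi : i ∉ a) (k : V) : blockInv a F i k = 0 := by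
  simp [blockInv, hi]

theorem blockInv_of_notMem_right (hk : k ∉ a) (i : V) : blockInv a F i k = 0 := by
  simp [blockInv, hk]

theorem blockInv_transpose : (blockInv a F).transpose = blockInv a F.transpose := by
  classical
  ext i k
  by_cases h : i ∈ a ∧ k ∈ a
  · rw [Matrix.transpose_apply, blockInv, blockInv, dif_pos h, dif_pos h.symm,
      ← Matrix.transpose_submatrix, ← Matrix.transpose_nonsing_inv]
    rfl
  · rw [Matrix.transpose_apply, blockInv, blockInv, dif_neg h, dif_neg fun h' => h h'.symm]

theorem mul_blockInv_apply (hF : IsRegularOn a F) (hi : i ∈ a) :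
    (F * blockInv a F) i k = (1 : Matrix V V ℝ) i k := by
  classical
  by_cases hk : k ∈ a
  · have hsum : (F * blockInv a F) i k = ∑ j : a, F i j *
        ((F.submatrix (Subtype.val : a → V) (Subtype.val : a → V))⁻¹) j ⟨k, hk⟩ :=
      Finset.sum_congr_set a (fun j => F i j * blockInv a F j k) _
        (fun j hj => congrArg (F i j * ·) (dif_pos ⟨hj, hk⟩))
        (fun j hj => mul_eq_zero_of_right _ (blockInv_of_notMem_left hj k))
    rw [hsum]
    refine (congrFun (congrFun (Matrix.mul_nonsing_inv _ hF) ⟨i, hi⟩) ⟨k, hk⟩).trans ?_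
    simp [Matrix.one_apply]
  · rw [Matrix.one_apply_ne (ne_of_mem_of_not_mem hi hk)]
    exact mul_apply_eq_zero_of_col (blockInv_of_notMem_right hk)

theorem blockInv_mul_apply (hF : IsRegularOn a F) (hk : k ∈ a) :
    (blockInv a F * F) i k = (1 : Matrix V V ℝ) i k := by
  rw [← Matrix.transpose_apply (blockInv a F * F), Matrix.transpose_mul, blockInv_transpose,
    mul_blockInv_apply hF.transpose hk, ← Matrix.transpose_apply 1, Matrix.transpose_one]

theorem blockInv_mul_mul_blockInv (hF : IsRegularOn a F) :
    blockInv a F * F * blockInv a F = blockInv a F := by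
  ext i k
  rw [Matrix.mul_apply]
  calc ∑ j, (blockInv a F * F) i j * blockInv a F j k
      = ∑ j, (1 : Matrix V V ℝ) i j * blockInv a F j k := by
        refine Finset.sum_congr rfl fun j _ => ?_
        by_cases hj : j ∈ a
        · rw [blockInv_mul_apply hF hj]
        · rw [blockInv_of_notMem_left hj, mul_zero, mul_zero]
    _ = blockInv a F i k := by rw [← Matrix.mul_apply, one_mul]

section StructuralZeros

variable {E : V → V → Prop}

/-- `F_aa` is block triangular for the set of nodes that can be reached from `s`, and so is its
inverse. -/
theorem reflTransGen_of_blockInv_ne_zero (hF : IsRegularOn a F)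
    (hE : ∀ i k, F i k ≠ 0 → E i k) {s t : V} (h : blockInv a F s t ≠ 0) :
    s ∈ a ∧ t ∈ a ∧ Relation.ReflTransGen (fun x y => x ∈ a ∧ y ∈ a ∧ E x y) s t := by
  classical
  have hs : s ∈ a := by_contra fun hs => h (blockInv_of_notMem_left hs t)
  have ht : t ∈ a := by_contra fun ht => h (blockInv_of_notMem_right ht s)
  refine ⟨hs, ht, by_contra fun hst => h ?_⟩
  rw [blockInv, dif_pos ⟨hs, ht⟩]
  let reached : a → ℕ := fun j =>
    if Relation.ReflTransGen (fun x y => x ∈ a ∧ y ∈ a ∧ E x y) s j then 1 else 0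
  have hblock : (F.submatrix (Subtype.val : a → V) Subtype.val).BlockTriangular reached := by
    intro i j hij
    by_contra hne
    by_cases hi : Relation.ReflTransGen (fun x y => x ∈ a ∧ y ∈ a ∧ E x y) s i
    · simp [reached, hi, hi.tail ⟨i.2, j.2, hE i j hne⟩] at hij
    · simp [reached, hi] at hij
  let _ := Matrix.invertibleOfIsUnitDet _ hF
  refine Matrix.blockTriangular_inv_of_blockTriangular hblock ?_
  simp [reached, if_neg hst, if_pos Relation.ReflTransGen.refl]

theorem linePath_of_mul_blockInv_mul_ne_zero (hF : IsRegularOn a F)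
    (hE : ∀ i k, F i k ≠ 0 → E i k) (h : (F * blockInv a F * F) i k ≠ 0) : LinePath a E i k := by
  obtain ⟨t, hit, htk⟩ := exists_ne_zero_of_mul_apply_ne_zero h
  obtain ⟨s, his, hst⟩ := exists_ne_zero_of_mul_apply_ne_zero hit
  obtain ⟨hs, ht, hpath⟩ := reflTransGen_of_blockInv_ne_zero hF hE hst
  exact ⟨s, hs, t, ht, hE _ _ his, hpath, hE _ _ htk⟩

theorem partialInv_eq_of_not_linePath (hF : IsRegularOn a F) (hE : ∀ i k, F i k ≠ 0 → E i k)
    (hi : i ∉ a) (hk : k ∉ a) (h : ¬ LinePath a E i k) : partialInv a F i k = F i k := by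
  have h0 : (F * blockInv a F * F) i k = 0 :=
    by_contra fun h' => h (linePath_of_mul_blockInv_mul_ne_zero hF hE h')
  rw [partialInv, if_neg hi, if_neg hk, Matrix.sub_apply, h0, sub_zero]

theorem partialClosure_of_partialInv_ne_zero (hF : IsRegularOn a F)
    (hE : ∀ i k, F i k ≠ 0 → E i k) (hrefl : ∀ i ∈ a, E i i) (h : partialInv a F i k ≠ 0) :
    partialClosure a E i k := by
  by_cases hi : i ∈ a <;> by_cases hk : k ∈ a
  · rw [partialInv, if_pos hi, if_pos hk] at h
    obtain ⟨-, -, hik⟩ := reflTransGen_of_blockInv_ne_zero hF hE h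
    exact .inr ⟨i, hi, k, hk, hrefl i hi, hik, hrefl k hk⟩
  · rw [partialInv, if_pos hi, if_neg hk, neg_ne_zero] at h
    obtain ⟨t, hit, htk⟩ := exists_ne_zero_of_mul_apply_ne_zero h
    obtain ⟨-, ht, hpath⟩ := reflTransGen_of_blockInv_ne_zero hF hE hit
    exact .inr ⟨i, hi, t, ht, hrefl i hi, hpath, hE _ _ htk⟩
  · rw [partialInv, if_neg hi, if_pos hk] at h
    obtain ⟨s, his, hsk⟩ := exists_ne_zero_of_mul_apply_ne_zero h
    obtain ⟨hs, -, hpath⟩ := reflTransGen_of_blockInv_ne_zero hF hE hsk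
    exact .inr ⟨s, hs, k, hk, hE _ _ his, hpath, hrefl k hk⟩
  · by_cases hpath : LinePath a E i k
    · exact .inr hpath
    · rw [partialInv_eq_of_not_linePath hF hE hi hk hpath] at h
      exact .inl (hE i k h)

end StructuralZeros

/-- The normal equations: `n` holds the coefficients of the residual in the least-squares regression
of component `i` on the components in `a`, for the covariance matrix `F`. -/
theorem partialInv_eq_neg_of_vecMul_eq_zero (hF : IsRegularOn a F) (hi : i ∉ a) (hk : k ∈ a)
    {n : V → ℝ} (hni : n i = 1) (hn : ∀ j ∉ a, j ≠ i → n j = 0)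
    (horth : ∀ r ∈ a, (n ᵥ* F) r = 0) : partialInv a F i k = -n k := by
  rw [partialInv, if_neg hi, if_pos hk, eq_neg_iff_add_eq_zero]
  have hik : i ≠ k := fun h => hi (h ▸ hk)
  calc (F * blockInv a F) i k + n k
      = n i * (F * blockInv a F) i k + n k * (F * blockInv a F) k k := by
        rw [hni, mul_blockInv_apply hF hk, Matrix.one_apply_eq, one_mul, mul_one]
    _ = ∑ j, n j * (F * blockInv a F) j k := by
        refine (Finset.sum_eq_add (f := fun j => n j * (F * blockInv a F) j k) i k hik
          (fun j _ hj => ?_) (by simp) (by simp)).symm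
        by_cases hja : j ∈ a
        · rw [mul_blockInv_apply hF hja, Matrix.one_apply_ne hj.2, mul_zero]
        · rw [hn j hja hj.1, zero_mul]
    _ = ∑ r, (n ᵥ* F) r * blockInv a F r k :=
        (congrFun (Matrix.vecMul_vecMul n F (blockInv a F)) k).symm
    _ = 0 := Finset.sum_eq_zero fun r _ => by
        by_cases hr : r ∈ a
        · rw [horth r hr, zero_mul]
        · rw [blockInv_of_notMem_left hr, mul_zero]

end PartialInversion

section Elimination

variable {V : Type} [Fintype V] [DecidableEq V] {a : Set V} {F : Matrix V V ℝ} {i k : V}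

/-- Block Gaussian elimination: multiplying the equations `F x = y` from the left by this matrix
removes the components `x_a`. -/
noncomputable def elimination (a : Set V) (F : Matrix V V ℝ) : Matrix V V ℝ :=
  1 - F * blockInv a F

theorem elimination_apply_of_mem_left (hF : IsRegularOn a F) (hi : i ∈ a) :
    elimination a F i k = 0 := by
  rw [elimination, Matrix.sub_apply, mul_blockInv_apply hF hi, sub_self]

theorem elimination_apply_of_notMem_right (hk : k ∉ a) :
    elimination a F i k = (1 : Matrix V V ℝ) i k := by
  have h0 : (F * blockInv a F) i k = 0 :=
    mul_apply_eq_zero_of_col (blockInv_of_notMem_right hk)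
  rw [elimination, Matrix.sub_apply, h0, sub_zero]

theorem mem_insert_of_elimination_ne_zero (h : elimination a F i k ≠ 0) : k ∈ insert i a := by
  by_contra hk
  rw [Set.mem_insert_iff, not_or] at hk
  exact h (by rw [elimination_apply_of_notMem_right hk.2, Matrix.one_apply_ne (Ne.symm hk.1)])

theorem elimination_apply_eq_neg_partialInv (hi : i ∉ a) (hk : k ∈ a) :
    elimination a F i k = -partialInv a F i k := by
  rw [elimination, Matrix.sub_apply, Matrix.one_apply_ne (ne_of_mem_of_not_mem hk hi).symm,
    zero_sub, partialInv, if_neg hi, if_pos hk]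

theorem elimination_mul_apply_of_mem_right (hF : IsRegularOn a F) (hk : k ∈ a) :
    (elimination a F * F) i k = 0 := by
  have h : (F * (blockInv a F * F)) i k = (F * (1 : Matrix V V ℝ)) i k :=
    mul_apply_congr_col fun _ => blockInv_mul_apply hF hk
  rw [elimination, sub_mul, one_mul, Matrix.sub_apply, mul_assoc, h, mul_one, sub_self]

theorem elimination_mul_apply_eq_partialInv (hi : i ∉ a) (hk : k ∉ a) :
    (elimination a F * F) i k = partialInv a F i k := by
  rw [elimination, sub_mul, one_mul, partialInv, if_neg hi, if_neg hk]

theorem elimination_transpose :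
    (elimination a F).transpose = 1 - blockInv a F.transpose * F.transpose := by
  rw [elimination, Matrix.transpose_sub, Matrix.transpose_one, Matrix.transpose_mul,
    blockInv_transpose]

end Elimination

/-! ## Parameters of the summary graph model -/

namespace ParentGraph

variable {d : ℕ} {G : ParentGraph d} {C M : Set (Fin d)} {A S : Matrix (Fin d) (Fin d) ℝ}
  {Δ : Fin d → ℝ} {i k : Fin d}

/-- The matrices `A` of the equations `A Y = ε` of the linear systems generated over `G`. -/
structure IsEquationMatrix (G : ParentGraph d) (A : Matrix (Fin d) (Fin d) ℝ) : Prop where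
  diag : ∀ i, A i i = 1
  edgeA_of_ne_zero : ∀ i k, A i k ≠ 0 → G.edgeA i k

theorem notMem_p_of_mem_u (hi : i ∈ G.u C M) : i ∉ G.p C M := fun h => hi.2 h.2

theorem notMem_v_of_mem_u (hi : i ∈ G.u C M) : i ∉ G.v C M := fun h => hi.1 (v_subset_right h)

namespace IsEquationMatrix

theorem arrow_of_ne_zero (hA : G.IsEquationMatrix A) (hne : k ≠ i) (h : A i k ≠ 0) :
    G.arrow i k :=
  (hA.edgeA_of_ne_zero i k h).resolve_left hne.symm

theorem eq_zero_of_mulVec (hA : G.IsEquationMatrix A) {f : Fin d → ℝ}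
    (hf : ∀ r ∈ G.right C, (A *ᵥ f) r = 0) : ∀ r ∈ G.right C, f r = 0 :=
  eq_zero_of_unitriangular_mulVec (fun r _ => hA.diag r)
    (fun _ hr _ hj h =>
      have hrj := hA.arrow_of_ne_zero hj h
      .inr ⟨mem_right_of_arrow hr hrj, G.lt_of_arrow _ _ hrj⟩) hf

theorem isRegularOn (hA : G.IsEquationMatrix A) (a : Set (Fin d)) : IsRegularOn a A :=
  isRegularOn_of_mulVec_eq_zero_imp fun _ hx h =>
    eq_zero_of_unitriangular_mulVec (fun r _ => hA.diag r)
      (fun _ _ j hj h => or_iff_not_imp_left.2 fun hxj =>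
        ⟨by_contra fun hja => hxj (hx j hja), G.lt_of_arrow _ _ (hA.arrow_of_ne_zero hj h)⟩) h

theorem posDef (hA : G.IsEquationMatrix A) (hΔ : ∀ i, 0 < Δ i)
    (hS : A * S * Aᵀ = Matrix.diagonal Δ) : S.PosDef := by
  have hunit : IsUnit A := by
    rw [Matrix.isUnit_iff_isUnit_det, Matrix.det_of_isUpperTriangular]
    · simp [hA.diag]
    · intro i j hji
      by_contra h
      exact absurd (G.lt_of_arrow _ _ (hA.arrow_of_ne_zero hji.ne h)) hji.not_gt
  rw [← Matrix.IsUnit.posDef_star_right_conjugate_iff hunit, Matrix.star_eq_conjTranspose,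
    Matrix.conjTranspose_eq_transpose_of_trivial, hS]
  exact Matrix.PosDef.diagonal hΔ

end IsEquationMatrix

theorem paramConc_eq : G.paramConc C A Δ =
    Aᵀ * Matrix.diagonal ((G.right C).indicator Δ⁻¹) * A := by
  classical
  ext r s
  rw [Matrix.mul_apply]
  refine Finset.sum_congr rfl fun t _ => ?_
  rw [Matrix.mul_diagonal, Matrix.transpose_apply, Set.indicator_apply]
  split_ifs
  · rfl
  · simp

theorem indicator_inv_nonneg (hΔ : ∀ i, 0 < Δ i) (a : Set (Fin d)) (t : Fin d) :
    0 ≤ a.indicator Δ⁻¹ t :=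
  Set.indicator_apply_nonneg fun _ => (inv_pos.2 (hΔ t)).le

theorem posSemidef_paramConc (hΔ : ∀ i, 0 < Δ i) : (G.paramConc C A Δ).PosSemidef := by
  rw [paramConc_eq, ← Matrix.conjTranspose_eq_transpose_of_trivial]
  exact (Matrix.PosSemidef.diagonal (indicator_inv_nonneg hΔ _)).conjTranspose_mul_mul_same A

theorem transpose_paramConc : (G.paramConc C A Δ)ᵀ = G.paramConc C A Δ := by
  rw [paramConc_eq, Matrix.transpose_mul, Matrix.transpose_mul, Matrix.transpose_transpose,
    Matrix.diagonal_transpose, mul_assoc]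

theorem isRegularOn_paramConc (hA : G.IsEquationMatrix A) (hΔ : ∀ i, 0 < Δ i) :
    IsRegularOn (G.q C M) (G.paramConc C A Δ) := by
  refine isRegularOn_of_mulVec_eq_zero_imp fun x hx h => ?_
  have hsum : ∑ t, (G.right C).indicator Δ⁻¹ t * (A *ᵥ x) t ^ 2 = 0 := by
    calc ∑ t, (G.right C).indicator Δ⁻¹ t * (A *ᵥ x) t ^ 2
        = x ⬝ᵥ (G.paramConc C A Δ *ᵥ x) := by
          rw [paramConc_eq, ← Matrix.mulVec_mulVec, ← Matrix.mulVec_mulVec,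
            Matrix.dotProduct_mulVec, Matrix.vecMul_transpose]
          refine Finset.sum_congr rfl fun t _ => ?_
          rw [Matrix.mulVec_diagonal]
          ring
      _ = 0 := Finset.sum_eq_zero fun r _ => by
          by_cases hr : r ∈ G.q C M
          · rw [h r hr, mul_zero]
          · rw [hx r hr, zero_mul]
  have hAx : ∀ t ∈ G.right C, (A *ᵥ x) t = 0 := by
    intro t ht
    have h0 := (Finset.sum_eq_zero_iff_of_nonneg fun t _ =>
      mul_nonneg (indicator_inv_nonneg hΔ _ t) (sq_nonneg _)).1 hsum t (Finset.mem_univ t)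
    rw [Set.indicator_of_mem ht] at h0
    exact pow_eq_zero_iff two_ne_zero |>.1
      ((mul_eq_zero.1 h0).resolve_left (inv_pos.2 (hΔ t)).ne')
  exact fun r hr => hA.eq_zero_of_mulVec hAx r (q_subset_right hr)

theorem edgeConc_of_ne_zero (hA : G.IsEquationMatrix A) (r s : Fin d)
    (h : G.paramConc C A Δ r s ≠ 0) : G.edgeConc C r s := by
  classical
  obtain ⟨t, -, ht⟩ := Finset.exists_ne_zero_of_sum_ne_zero h
  obtain ⟨htR, ht⟩ := ite_ne_right_iff.1 ht
  exact ⟨t, htR, hA.edgeA_of_ne_zero _ _ (left_ne_zero_of_mul (left_ne_zero_of_mul ht)),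
    hA.edgeA_of_ne_zero _ _ (right_ne_zero_of_mul ht)⟩

theorem mem_right_of_paramConc_ne_zero (hA : G.IsEquationMatrix A) {r s : Fin d}
    (h : G.paramConc C A Δ r s ≠ 0) : s ∈ G.right C := by
  obtain ⟨t, ht, -, rfl | hts⟩ := edgeConc_of_ne_zero hA r s h
  exacts [ht, mem_right_of_arrow ht hts]

theorem edgeD_of_ne_zero (hA : G.IsEquationMatrix A) (h : G.paramD C M A i k ≠ 0) :
    G.edgeD C M i k :=
  partialClosure_of_partialInv_ne_zero (hA.isRegularOn _) hA.edgeA_of_ne_zero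
    (fun _ _ => .inl rfl) h

theorem edgeZ_of_ne_zero (hA : G.IsEquationMatrix A) (hΔ : ∀ i, 0 < Δ i)
    (h : G.paramQ C M A Δ i k ≠ 0) : G.edgeZ C M i k :=
  partialClosure_of_partialInv_ne_zero (isRegularOn_paramConc hA hΔ) (edgeConc_of_ne_zero hA)
    (fun _ hi => edgeConc_refl (q_subset_right hi)) h

theorem edgeW_of_ne_zero (hA : G.IsEquationMatrix A) (hΔ : ∀ i, 0 < Δ i)
    (i k : Fin d) (h : G.paramW C M A Δ i k ≠ 0) : G.edgeW C M i k := by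
  classical
  by_contra hW
  simp only [edgeW, not_or] at hW
  obtain ⟨hik, hp, hq⟩ := hW
  refine h ?_
  rw [paramW, if_neg hik, zero_add, Finset.sum_eq_zero, Finset.sum_eq_zero, add_zero]
  · refine fun s _ => Finset.sum_eq_zero fun t _ => ite_eq_right_iff.2 fun hst => ?_
    by_contra h0
    exact hq ⟨s, hst.1, t, hst.2,
      edgeD_of_ne_zero hA (left_ne_zero_of_mul (left_ne_zero_of_mul h0)),
      edgeZ_of_ne_zero hA hΔ (right_ne_zero_of_mul (left_ne_zero_of_mul h0)),
      edgeD_of_ne_zero hA (right_ne_zero_of_mul h0)⟩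
  · refine fun s _ => ite_eq_right_iff.2 fun hsp => ?_
    by_contra h0
    exact hp ⟨s, hsp, edgeD_of_ne_zero hA (left_ne_zero_of_mul (left_ne_zero_of_mul h0)),
      edgeD_of_ne_zero hA (right_ne_zero_of_mul h0)⟩

theorem paramH_eq_of_not_inducedArrow (hA : G.IsEquationMatrix A) (hΔ : ∀ i, 0 < Δ i)
    (hi : i ∈ G.u C M) (hk : k ∉ M) (h : ¬ G.InducedArrow C M i k) :
    G.paramH C M A Δ i k = A i k := by
  classical
  rw [InducedArrow, not_or] at h
  have hD : G.paramD C M A i k = A i k :=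
    partialInv_eq_of_not_linePath (hA.isRegularOn _) hA.edgeA_of_ne_zero (notMem_p_of_mem_u hi)
      (fun h => hk h.2) h.1
  rw [paramH, hD]
  refine ite_eq_right_iff.2 fun hkv => add_eq_left.2 <| Finset.sum_eq_zero fun s _ =>
    ite_eq_right_iff.2 fun hsq => ?_
  by_contra h0
  exact h.2 ⟨hkv, s, hsq, edgeD_of_ne_zero hA (left_ne_zero_of_mul h0),
    edgeZ_of_ne_zero hA hΔ (right_ne_zero_of_mul h0)⟩

theorem edgeH_of_ne_zero (hA : G.IsEquationMatrix A) (hΔ : ∀ i, 0 < Δ i) (hi : i ∈ G.u C M)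
    (hk : k ∉ M) (h : G.paramH C M A Δ i k ≠ 0) : G.edgeH C M i k := by
  by_contra h'
  rw [edgeH, not_or] at h'
  rw [paramH_eq_of_not_inducedArrow hA hΔ hi hk h'.2] at h
  exact h'.1 (hA.edgeA_of_ne_zero i k h)

theorem paramD_self (hA : G.IsEquationMatrix A) (hi : i ∈ G.u C M) :
    G.paramD C M A i i = 1 := by
  rw [paramD, partialInv_eq_of_not_linePath (hA.isRegularOn _) hA.edgeA_of_ne_zero
    (notMem_p_of_mem_u hi) (notMem_p_of_mem_u hi), hA.diag]
  intro hpath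
  obtain ⟨t, htp, hit, hti⟩ := hpath.exists_partialClosure
  have hne : t ≠ i := fun h => notMem_p_of_mem_u hi (h ▸ htp)
  exact lt_asymm (lt_of_ancestor ((eq_or_ancestor_of_edgeD hit).resolve_left hne.symm))
    (G.lt_of_arrow _ _ (hti.resolve_left hne))

theorem paramW_eq : G.paramW C M A Δ = Matrix.diagonal Δ
    + G.paramD C M A * Matrix.diagonal ((G.p C M).indicator Δ) * (G.paramD C M A)ᵀ
    + G.paramD C M A * blockInv (G.q C M) (G.paramConc C A Δ) * (G.paramD C M A)ᵀ := by
  classical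
  ext i k
  rw [Matrix.add_apply, Matrix.add_apply, paramW, Matrix.diagonal_apply]
  congr 2
  · rw [Matrix.mul_apply]
    refine Finset.sum_congr rfl fun s _ => ?_
    rw [Matrix.mul_diagonal, Matrix.transpose_apply, Set.indicator_apply]
    split_ifs <;> simp
  · rw [Finset.sum_comm, Matrix.mul_apply]
    refine Finset.sum_congr rfl fun t _ => ?_
    rw [Matrix.mul_apply, Finset.sum_mul]
    refine Finset.sum_congr rfl fun s _ => ?_
    split_ifs with h
    · rw [paramQ, partialInv, if_pos h.1, if_pos h.2, Matrix.transpose_apply]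
    · rw [blockInv, dif_neg h, mul_zero, zero_mul]

theorem posDef_paramW (hA : G.IsEquationMatrix A) (hΔ : ∀ i, 0 < Δ i) :
    (G.paramW C M A Δ).PosDef := by
  have hZ : (blockInv (G.q C M) (G.paramConc C A Δ)).PosSemidef := by
    have h := (posSemidef_paramConc (G := G) (C := C) (A := A) hΔ).mul_mul_conjTranspose_same
      (blockInv (G.q C M) (G.paramConc C A Δ))
    rwa [Matrix.conjTranspose_eq_transpose_of_trivial, blockInv_transpose, transpose_paramConc,
      blockInv_mul_mul_blockInv (isRegularOn_paramConc hA hΔ)] at h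
  have hp : (Matrix.diagonal ((G.p C M).indicator Δ)).PosSemidef :=
    .diagonal fun t => Set.indicator_apply_nonneg fun _ => (hΔ t).le
  rw [paramW_eq, ← Matrix.conjTranspose_eq_transpose_of_trivial]
  exact ((Matrix.PosDef.diagonal hΔ).add_posSemidef (hp.mul_mul_conjTranspose_same _))
    |>.add_posSemidef (hZ.mul_mul_conjTranspose_same _)

end ParentGraph

/-! ## Equations of the summary graph model and the MAG regression -/

namespace ParentGraph

variable {d : ℕ} {G : ParentGraph d} {C M : Set (Fin d)} {A S : Matrix (Fin d) (Fin d) ℝ}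
  {Δ : Fin d → ℝ} {i k : Fin d}

/-- The coefficients of `A Y = ε` after elimination of `Y_p`. -/
noncomputable def marginCoef (G : ParentGraph d) (C M : Set (Fin d))
    (A : Matrix (Fin d) (Fin d) ℝ) : Matrix (Fin d) (Fin d) ℝ :=
  elimination (G.p C M) A * A

/-- Row `i ∈ u` holds the coefficients of `Y` in the residual `η_i` of the summary graph model:
after elimination of `Y_p`, the component `Y_q` is replaced by its regression on `Y_v` and `Y_C`. -/
noncomputable def summaryCoef (G : ParentGraph d) (C M : Set (Fin d))
    (A : Matrix (Fin d) (Fin d) ℝ) (Δ : Fin d → ℝ) : Matrix (Fin d) (Fin d) ℝ :=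
  G.marginCoef C M A * (elimination (G.q C M) (G.paramConc C A Δ))ᵀ

/-- Row `i` holds the coefficients of `Y` in the residual of the MAG regression of `Y_i`: the
residual `η_i` minus its regression on the `η_j` with `j ∈ c_i`. -/
noncomputable def magCoef (G : ParentGraph d) (C M : Set (Fin d))
    (A : Matrix (Fin d) (Fin d) ℝ) (Δ : Fin d → ℝ) (i : Fin d) : Matrix (Fin d) (Fin d) ℝ :=
  elimination (G.anc C M i) (G.paramW C M A Δ) * G.summaryCoef C M A Δ

section SummaryCoef

theorem notMem_right_of_elimination_ne_zero {t : Fin d} (hi : i ∈ G.u C M)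
    (h : elimination (G.p C M) A i t ≠ 0) : t ∉ G.right C := by
  rcases mem_insert_of_elimination_ne_zero h with rfl | ht
  exacts [hi.1, ht.1]

theorem marginCoef_eq_paramD (hi : i ∈ G.u C M) (hk : k ∉ G.p C M) :
    G.marginCoef C M A i k = G.paramD C M A i k :=
  elimination_mul_apply_eq_partialInv (notMem_p_of_mem_u hi) hk

theorem summaryCoef_eq : G.summaryCoef C M A Δ = G.marginCoef C M A
    - G.marginCoef C M A * (blockInv (G.q C M) (G.paramConc C A Δ) * G.paramConc C A Δ) := by
  rw [summaryCoef, elimination_transpose, transpose_paramConc, mul_sub, mul_one]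

theorem summaryCoef_apply_of_notMem_right (hA : G.IsEquationMatrix A) (hk : k ∉ G.right C) :
    G.summaryCoef C M A Δ i k = G.marginCoef C M A i k := by
  have h0 : (G.marginCoef C M A *
      (blockInv (G.q C M) (G.paramConc C A Δ) * G.paramConc C A Δ)) i k = 0 := by
    by_contra h
    obtain ⟨t, -, ht⟩ := exists_ne_zero_of_mul_apply_ne_zero h
    obtain ⟨s, -, hs⟩ := exists_ne_zero_of_mul_apply_ne_zero ht
    exact hk (mem_right_of_paramConc_ne_zero hA hs)
  rw [summaryCoef_eq, Matrix.sub_apply, h0, sub_zero]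

theorem summaryCoef_apply_eq_zero (hA : G.IsEquationMatrix A) (hΔ : ∀ i, 0 < Δ i)
    (hk : k ∈ G.p C M ∪ G.q C M) : G.summaryCoef C M A Δ i k = 0 := by
  rcases hk with hk | hk
  · rw [summaryCoef_apply_of_notMem_right hA hk.1]
    exact elimination_mul_apply_of_mem_right (hA.isRegularOn _) hk
  · exact mul_apply_eq_zero_of_col fun _ =>
      elimination_apply_of_mem_left (isRegularOn_paramConc hA hΔ) hk

theorem summaryCoef_eq_paramH (hA : G.IsEquationMatrix A) (hi : i ∈ G.u C M)
    (hk : k ∈ G.u C M ∨ k ∈ G.v C M) : G.summaryCoef C M A Δ i k = G.paramH C M A Δ i k := by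
  classical
  rcases hk with hk | hk
  · rw [summaryCoef_apply_of_notMem_right hA hk.1, paramH, if_neg (notMem_v_of_mem_u hk),
      marginCoef_eq_paramD hi (notMem_p_of_mem_u hk)]
  · have hkp : k ∉ G.p C M := fun h => hk.2 h.2
    have hkq : k ∉ G.q C M := fun h => hk.2 h.2
    rw [summaryCoef_eq, Matrix.sub_apply, paramH, if_pos hk, marginCoef_eq_paramD hi hkp,
      sub_eq_add_neg, Matrix.mul_apply, ← Finset.sum_neg_distrib]
    refine congrArg _ (Finset.sum_congr rfl fun s _ => ?_)
    split_ifs with hs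
    · rw [paramQ, partialInv, if_pos hs, if_neg hkq,
        marginCoef_eq_paramD hi fun h => h.1 (q_subset_right hs), mul_neg]
    · have h0 : (blockInv (G.q C M) (G.paramConc C A Δ) * G.paramConc C A Δ) s k = 0 :=
        mul_apply_eq_zero_of_row (blockInv_of_notMem_left hs)
      rw [h0, mul_zero, neg_zero]

theorem summaryCoef_self (hA : G.IsEquationMatrix A) (hi : i ∈ G.u C M) :
    G.summaryCoef C M A Δ i i = 1 := by
  rw [summaryCoef_apply_of_notMem_right hA hi.1, marginCoef_eq_paramD hi (notMem_p_of_mem_u hi),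
    paramD_self hA hi]

theorem mem_u_and_ancestor_of_summaryCoef_ne_zero (hA : G.IsEquationMatrix A)
    (hΔ : ∀ i, 0 < Δ i) (hi : i ∈ G.u C M) (hk : k ∉ C ∪ G.v C M) (hki : k ≠ i)
    (h : G.summaryCoef C M A Δ i k ≠ 0) : k ∈ G.u C M ∧ G.toMixed.Ancestor i k := by
  rw [Set.mem_union, not_or] at hk
  have hkM : k ∉ M := fun hkM => h <| summaryCoef_apply_eq_zero hA hΔ <| by
    by_cases hkR : k ∈ G.right C
    exacts [.inr ⟨hkR.resolve_left hk.1, hkM⟩, .inl ⟨hkR, hkM⟩]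
  have hku : k ∈ G.u C M := ⟨fun hkR => hk.2 ⟨hkR.resolve_left hk.1, hkM⟩, hkM⟩
  rw [summaryCoef_apply_of_notMem_right hA hku.1,
    marginCoef_eq_paramD hi (notMem_p_of_mem_u hku)] at h
  exact ⟨hku, (eq_or_ancestor_of_edgeD (edgeD_of_ne_zero hA h)).resolve_left hki.symm⟩

end SummaryCoef

section Covariance

/-- The residuals outside `R` are uncorrelated with `Y_R`, which is a function of `ε_R` alone. -/
theorem mul_cov_apply_eq_zero (hA : G.IsEquationMatrix A) (hS : A * S * Aᵀ = Matrix.diagonal Δ)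
    {t r : Fin d} (ht : t ∉ G.right C) (hr : r ∈ G.right C) : (A * S) t r = 0 := by
  refine hA.eq_zero_of_mulVec (f := (A * S) t) (fun r hr => ?_) r hr
  rw [← Matrix.vecMul_transpose]
  refine (congrFun (congrFun hS t) r).trans (Matrix.diagonal_apply_ne _ ?_)
  exact (ne_of_mem_of_not_mem hr ht).symm

theorem paramConc_mul_cov_mul_transpose (hΔ : ∀ i, 0 < Δ i)
    (hS : A * S * Aᵀ = Matrix.diagonal Δ) : G.paramConc C A Δ * S * Aᵀ =
      Aᵀ * Matrix.diagonal ((G.right C).indicator 1) := by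
  rw [paramConc_eq, mul_assoc (Aᵀ * _), mul_assoc (Aᵀ * _), hS, mul_assoc Aᵀ,
    Matrix.diagonal_mul_diagonal]
  congr 2
  ext t
  by_cases ht : t ∈ G.right C
  · simp [ht, (hΔ t).ne']
  · simp [ht]

theorem paramConc_mul_cov_apply (hA : G.IsEquationMatrix A) (hΔ : ∀ i, 0 < Δ i)
    (hS : A * S * Aᵀ = Matrix.diagonal Δ) {j r : Fin d} (hr : r ∈ G.right C) :
    (G.paramConc C A Δ * S) j r = (1 : Matrix (Fin d) (Fin d) ℝ) j r := by
  rw [← sub_eq_zero, ← Matrix.sub_apply]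
  refine hA.eq_zero_of_mulVec (f := (G.paramConc C A Δ * S - 1) j) (fun r hr => ?_) r hr
  rw [← Matrix.vecMul_transpose]
  change ((G.paramConc C A Δ * S - 1) * Aᵀ) j r = 0
  rw [sub_mul, one_mul, paramConc_mul_cov_mul_transpose hΔ hS, Matrix.sub_apply,
    Matrix.mul_diagonal, Set.indicator_of_mem hr, Pi.one_apply, mul_one, sub_self]

theorem summaryCoef_mul_cov_apply (hA : G.IsEquationMatrix A) (hΔ : ∀ i, 0 < Δ i)
    (hS : A * S * Aᵀ = Matrix.diagonal Δ) (hi : i ∈ G.u C M) {r : Fin d} (hr : r ∈ G.right C) :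
    (G.summaryCoef C M A Δ * S) i r =
      -(G.marginCoef C M A * blockInv (G.q C M) (G.paramConc C A Δ)) i r := by
  have hmargin : (G.marginCoef C M A * S) i r = 0 := by
    rw [marginCoef, mul_assoc]
    by_contra h
    obtain ⟨t, hit, htr⟩ := exists_ne_zero_of_mul_apply_ne_zero h
    exact htr (mul_cov_apply_eq_zero hA hS (notMem_right_of_elimination_ne_zero hi hit) hr)
  rw [summaryCoef_eq, sub_mul, Matrix.sub_apply, hmargin, zero_sub, ← mul_assoc,
    mul_assoc _ (G.paramConc C A Δ),
    mul_apply_congr_col fun _ => paramConc_mul_cov_apply hA hΔ hS hr, mul_one]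

theorem summaryCoef_mul_cov_apply_eq_zero (hA : G.IsEquationMatrix A) (hΔ : ∀ i, 0 < Δ i)
    (hS : A * S * Aᵀ = Matrix.diagonal Δ) (hi : i ∈ G.u C M) {r : Fin d} (hr : r ∈ G.right C)
    (hrq : r ∉ G.q C M) : (G.summaryCoef C M A Δ * S) i r = 0 := by
  rw [summaryCoef_mul_cov_apply hA hΔ hS hi hr, neg_eq_zero]
  exact mul_apply_eq_zero_of_col (blockInv_of_notMem_right hrq)

theorem summaryCoef_mul_cov_mul_marginCoef_transpose (hΔ : ∀ i, 0 < Δ i)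
    (hS : A * S * Aᵀ = Matrix.diagonal Δ) (hk : k ∈ G.u C M) :
    (G.summaryCoef C M A Δ * S * (G.marginCoef C M A)ᵀ) i k =
      (elimination (G.p C M) A * Matrix.diagonal Δ * (elimination (G.p C M) A)ᵀ) i k := by
  set L := elimination (G.p C M) A with hL
  set K := G.marginCoef C M A with hK
  set Z := blockInv (G.q C M) (G.paramConc C A Δ) with hZ
  let E : Matrix (Fin d) (Fin d) ℝ := Matrix.diagonal ((G.right C).indicator 1)
  have hconc : (K * Z * Aᵀ * (E * Lᵀ)) i k = 0 := by
    refine mul_apply_eq_zero_of_col fun t => ?_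
    rw [Matrix.diagonal_mul, Matrix.transpose_apply]
    by_cases ht : t ∈ G.right C
    · exact mul_eq_zero_of_right _ <| by_contra fun h =>
        notMem_right_of_elimination_ne_zero hk h ht
    · rw [Set.indicator_of_notMem ht, zero_mul]
  calc (G.summaryCoef C M A Δ * S * Kᵀ) i k
      = (L * (A * S * Aᵀ) * Lᵀ - K * Z * (G.paramConc C A Δ * S * Aᵀ) * Lᵀ) i k := by
        rw [summaryCoef_eq, hK, marginCoef, Matrix.transpose_mul, ← hL, ← hZ]
        noncomm_ring
    _ = (L * Matrix.diagonal Δ * Lᵀ) i k := by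
        rw [hS, paramConc_mul_cov_mul_transpose hΔ hS, ← mul_assoc (K * Z), mul_assoc _ E,
          Matrix.sub_apply, hconc, sub_zero]

theorem elimination_mul_diagonal_mul_transpose (hi : i ∈ G.u C M) (hk : k ∈ G.u C M) :
    (elimination (G.p C M) A * Matrix.diagonal Δ * (elimination (G.p C M) A)ᵀ) i k =
      (Matrix.diagonal Δ + G.paramD C M A * Matrix.diagonal ((G.p C M).indicator Δ) *
        (G.paramD C M A)ᵀ) i k := by
  have hdiag : Matrix.diagonal Δ = (1 : Matrix (Fin d) (Fin d) ℝ) * Matrix.diagonal Δ * 1ᵀ := by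
    simp
  rw [Matrix.add_apply, congrFun₂ hdiag i k, Matrix.mul_apply, Matrix.mul_apply, Matrix.mul_apply,
    ← Finset.sum_add_distrib]
  refine Finset.sum_congr rfl fun t _ => ?_
  simp only [Matrix.mul_diagonal, Matrix.transpose_apply]
  by_cases ht : t ∈ G.p C M
  · have hti : i ≠ t := (ne_of_mem_of_not_mem ht (notMem_p_of_mem_u hi)).symm
    rw [elimination_apply_eq_neg_partialInv (notMem_p_of_mem_u hi) ht,
      elimination_apply_eq_neg_partialInv (notMem_p_of_mem_u hk) ht, Set.indicator_of_mem ht,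
      Matrix.one_apply_ne hti, paramD]
    ring
  · rw [elimination_apply_of_notMem_right ht, elimination_apply_of_notMem_right ht,
      Set.indicator_of_notMem ht, mul_zero, zero_mul, add_zero]

theorem marginCoef_mul_blockInv_mul_transpose (hi : i ∈ G.u C M) (hk : k ∈ G.u C M) :
    (G.marginCoef C M A * blockInv (G.q C M) (G.paramConc C A Δ) * (G.marginCoef C M A)ᵀ) i k =
      (G.paramD C M A * blockInv (G.q C M) (G.paramConc C A Δ) * (G.paramD C M A)ᵀ) i k := by
  have hq : ∀ {i s}, i ∈ G.u C M → s ∈ G.q C M → G.marginCoef C M A i s = G.paramD C M A i s :=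
    fun hi hs => marginCoef_eq_paramD hi fun h => h.1 (q_subset_right hs)
  rw [Matrix.mul_apply, Matrix.mul_apply]
  refine Finset.sum_congr rfl fun t _ => ?_
  by_cases ht : t ∈ G.q C M
  · rw [Matrix.transpose_apply, Matrix.transpose_apply, hq hk ht, Matrix.mul_apply,
      Matrix.mul_apply]
    refine congrArg (· * _) (Finset.sum_congr rfl fun s _ => ?_)
    by_cases hs : s ∈ G.q C M
    · rw [hq hi hs]
    · rw [blockInv_of_notMem_left hs, mul_zero, mul_zero]
  · rw [mul_apply_eq_zero_of_col (blockInv_of_notMem_right ht),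
      mul_apply_eq_zero_of_col (blockInv_of_notMem_right ht), zero_mul, zero_mul]

theorem summaryCoef_mul_cov_mul_transpose (hA : G.IsEquationMatrix A) (hΔ : ∀ i, 0 < Δ i)
    (hS : A * S * Aᵀ = Matrix.diagonal Δ) (hi : i ∈ G.u C M) (hk : k ∈ G.u C M) :
    (G.summaryCoef C M A Δ * S * (G.summaryCoef C M A Δ)ᵀ) i k = G.paramW C M A Δ i k := by
  set T := G.summaryCoef C M A Δ with hT
  set K := G.marginCoef C M A
  set Q := G.paramConc C A Δ with hQ
  set Z := blockInv (G.q C M) Q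
  have hTt : Tᵀ = Kᵀ - Q * (Z * Kᵀ) := by
    rw [hT, summaryCoef_eq, Matrix.transpose_sub, Matrix.transpose_mul, Matrix.transpose_mul,
      blockInv_transpose, transpose_paramConc, mul_assoc]
  have hconc : (T * S * (Q * (Z * Kᵀ))) i k = -(K * Z * Kᵀ) i k := by
    calc (T * S * (Q * (Z * Kᵀ))) i k = (-(K * Z) * (Q * (Z * Kᵀ))) i k := by
          rw [Matrix.mul_apply, Matrix.mul_apply]
          refine Finset.sum_congr rfl fun r _ => ?_
          by_cases hr : r ∈ G.right C
          · exact congrArg (· * _) (summaryCoef_mul_cov_apply hA hΔ hS hi hr)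
          · have h0 : (Q * (Z * Kᵀ)) r k = 0 := mul_apply_eq_zero_of_row fun s => by
              rw [hQ, ← transpose_paramConc]
              exact by_contra fun h => hr (mem_right_of_paramConc_ne_zero hA h)
            rw [h0, mul_zero, mul_zero]
      _ = (-(K * (Z * Q * Z) * Kᵀ)) i k := by noncomm_ring
      _ = -(K * Z * Kᵀ) i k := by
          rw [blockInv_mul_mul_blockInv (isRegularOn_paramConc hA hΔ), Matrix.neg_apply]
  rw [hTt, mul_sub, Matrix.sub_apply, hconc, sub_neg_eq_add,
    summaryCoef_mul_cov_mul_marginCoef_transpose hΔ hS hk,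
    elimination_mul_diagonal_mul_transpose hi hk, marginCoef_mul_blockInv_mul_transpose hi hk,
    ← Matrix.add_apply, ← paramW_eq]

end Covariance

section MagRegression

theorem mem_u_of_mem_insert_anc {m : Fin d} (hi : i ∈ G.u C M)
    (hm : m ∈ insert i (G.anc C M i)) : m ∈ G.u C M := by
  rcases hm with rfl | hm
  exacts [hi, hm.1]

theorem notMem_magRegressors (hi : i ∈ G.u C M) : i ∉ G.anc C M i ∪ G.v C M ∪ C := by
  rintro ((h | h) | h)
  exacts [ne_of_mem_anc h rfl, notMem_v_of_mem_u hi h, hi.1 (.inl h)]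

theorem summaryCoef_apply_eq_zero_of_notMem (hA : G.IsEquationMatrix A) (hΔ : ∀ i, 0 < Δ i)
    (hi : i ∈ G.u C M) {m j : Fin d} (hm : m ∈ insert i (G.anc C M i))
    (hj : j ∉ G.anc C M i ∪ G.v C M ∪ C) (hjm : j ≠ m) : G.summaryCoef C M A Δ m j = 0 := by
  by_contra h
  obtain ⟨hju, hmj⟩ := mem_u_and_ancestor_of_summaryCoef_ne_zero hA hΔ
    (mem_u_of_mem_insert_anc hi hm) (fun h' => hj (h'.elim .inr fun h' => .inl (.inr h'))) hjm h
  refine hj (.inl (.inl ⟨hju, ?_⟩))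
  rcases hm with rfl | hm
  exacts [hmj, hm.2.trans hmj]

theorem magCoef_self (hA : G.IsEquationMatrix A) (hΔ : ∀ i, 0 < Δ i) (hi : i ∈ G.u C M) :
    G.magCoef C M A Δ i i i = 1 := by
  have hic : i ∉ G.anc C M i := fun h => ne_of_mem_anc h rfl
  rw [magCoef, Matrix.mul_apply, Finset.sum_eq_single i _ (by simp), summaryCoef_self hA hi,
    elimination_apply_of_notMem_right hic, Matrix.one_apply_eq, one_mul]
  intro m _ hmi
  by_cases hm : m ∈ insert i (G.anc C M i)
  · rw [summaryCoef_apply_eq_zero_of_notMem hA hΔ hi hm (notMem_magRegressors hi) hmi.symm,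
      mul_zero]
  · rw [not_imp_comm.1 mem_insert_of_elimination_ne_zero hm, zero_mul]

theorem magCoef_apply_eq_zero (hA : G.IsEquationMatrix A) (hΔ : ∀ i, 0 < Δ i) (hi : i ∈ G.u C M)
    {j : Fin d} (hj : j ∉ G.anc C M i ∪ G.v C M ∪ C) (hji : j ≠ i) :
    G.magCoef C M A Δ i i j = 0 := by
  by_contra h
  obtain ⟨m, him, hmj⟩ := exists_ne_zero_of_mul_apply_ne_zero h
  have hm := mem_insert_of_elimination_ne_zero him
  refine hmj (summaryCoef_apply_eq_zero_of_notMem hA hΔ hi hm hj ?_)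
  rcases hm with rfl | hm
  exacts [hji, fun h => hj (.inl (.inl (h ▸ hm)))]

theorem magCoef_mul_cov_apply_eq_zero_of_mem_right (hA : G.IsEquationMatrix A)
    (hΔ : ∀ i, 0 < Δ i) (hS : A * S * Aᵀ = Matrix.diagonal Δ) (hi : i ∈ G.u C M) {r : Fin d}
    (hr : r ∈ C ∪ G.v C M) : (G.magCoef C M A Δ i * S) i r = 0 := by
  have hrq : r ∉ G.q C M := fun hrq => hr.elim hrq.1.1 fun h => h.2 hrq.2
  rw [magCoef, mul_assoc]
  by_contra h
  obtain ⟨m, him, hmr⟩ := exists_ne_zero_of_mul_apply_ne_zero h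
  have hmu := mem_u_of_mem_insert_anc hi (mem_insert_of_elimination_ne_zero him)
  exact hmr (summaryCoef_mul_cov_apply_eq_zero hA hΔ hS hmu (hr.imp_right And.left) hrq)

theorem magCoef_mul_cov_mul_transpose_eq_zero (hA : G.IsEquationMatrix A) (hΔ : ∀ i, 0 < Δ i)
    (hS : A * S * Aᵀ = Matrix.diagonal Δ) (hi : i ∈ G.u C M) {r : Fin d}
    (hr : r ∈ G.anc C M i) :
    (G.magCoef C M A Δ i * S * (G.summaryCoef C M A Δ)ᵀ) i r = 0 := by
  rw [magCoef, mul_assoc, mul_assoc, ← mul_assoc (G.summaryCoef C M A Δ),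
    ← elimination_mul_apply_of_mem_right (F := G.paramW C M A Δ) (i := i)
      (isRegularOn_of_posDef (posDef_paramW hA hΔ)) hr, Matrix.mul_apply, Matrix.mul_apply]
  refine Finset.sum_congr rfl fun m _ => ?_
  by_cases hm : m ∈ insert i (G.anc C M i)
  · rw [summaryCoef_mul_cov_mul_transpose hA hΔ hS (mem_u_of_mem_insert_anc hi hm) hr.1]
  · rw [not_imp_comm.1 mem_insert_of_elimination_ne_zero hm, zero_mul, zero_mul]

theorem magCoef_mul_cov_apply_eq_zero (hA : G.IsEquationMatrix A) (hΔ : ∀ i, 0 < Δ i)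
    (hS : A * S * Aᵀ = Matrix.diagonal Δ) (hi : i ∈ G.u C M) {r : Fin d}
    (hr : r ∈ G.anc C M i ∪ G.v C M ∪ C) : (G.magCoef C M A Δ i * S) i r = 0 := by
  rcases hr with (hr | hr) | hr
  · refine eq_zero_of_unitriangular_mulVec (F := G.summaryCoef C M A Δ)
      (f := (G.magCoef C M A Δ i * S) i) (fun r hr => summaryCoef_self hA hr.1)
      (fun r hr j hj h => ?_) (fun r hr => ?_) r hr
    · by_cases hjR : j ∈ C ∪ G.v C M
      · exact .inl (magCoef_mul_cov_apply_eq_zero_of_mem_right hA hΔ hS hi hjR)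
      · obtain ⟨hju, hrj⟩ := mem_u_and_ancestor_of_summaryCoef_ne_zero hA hΔ hr.1 hjR hj h
        exact .inr ⟨⟨hju, hr.2.trans hrj⟩, lt_of_ancestor hrj⟩
    · rw [← Matrix.vecMul_transpose]
      exact magCoef_mul_cov_mul_transpose_eq_zero hA hΔ hS hi hr
  · exact magCoef_mul_cov_apply_eq_zero_of_mem_right hA hΔ hS hi (.inr hr)
  · exact magCoef_mul_cov_apply_eq_zero_of_mem_right hA hΔ hS hi (.inl hr)

theorem partialInv_cov_eq_neg_magCoef (hA : G.IsEquationMatrix A) (hΔ : ∀ i, 0 < Δ i)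
    (hS : A * S * Aᵀ = Matrix.diagonal Δ) (hi : i ∈ G.u C M)
    (hk : k ∈ G.anc C M i ∪ G.v C M ∪ C) :
    partialInv (G.anc C M i ∪ G.v C M ∪ C) S i k = -G.magCoef C M A Δ i i k :=
  partialInv_eq_neg_of_vecMul_eq_zero (isRegularOn_of_posDef (hA.posDef hΔ hS))
    (notMem_magRegressors hi) hk (magCoef_self hA hΔ hi)
    (fun _ => magCoef_apply_eq_zero hA hΔ hi)
    (fun _ => magCoef_mul_cov_apply_eq_zero hA hΔ hS hi)

theorem magCoef_eq_paramH (hA : G.IsEquationMatrix A) (hΔ : ∀ i, 0 < Δ i) (hi : i ∈ G.u C M)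
    (hk : k ∈ G.u C M ∨ k ∈ G.v C M) (h : ¬ G.InducedByAncestors C M i k) :
    G.magCoef C M A Δ i i k = G.paramH C M A Δ i k := by
  have h0 : (G.paramW C M A Δ * blockInv (G.anc C M i) (G.paramW C M A Δ) *
      G.summaryCoef C M A Δ) i k = 0 := by
    by_contra h0
    obtain ⟨l, hil, hlk⟩ := exists_ne_zero_of_mul_apply_ne_zero h0
    obtain ⟨j, hij, hjl⟩ := exists_ne_zero_of_mul_apply_ne_zero hil
    obtain ⟨hj, hl, hpath⟩ := reflTransGen_of_blockInv_ne_zero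
      (isRegularOn_of_posDef (posDef_paramW hA hΔ)) (edgeW_of_ne_zero hA hΔ) hjl
    rw [summaryCoef_eq_paramH hA hl.1 hk] at hlk
    exact h ⟨j, hj, l, hl, edgeW_of_ne_zero hA hΔ i j hij, hpath,
      edgeH_of_ne_zero hA hΔ hl.1 (hk.elim And.right And.right) hlk⟩
  rw [magCoef, elimination, sub_mul, one_mul, Matrix.sub_apply, h0, sub_zero,
    summaryCoef_eq_paramH hA hi hk]

end MagRegression

end ParentGraph

/-! ## Linear triangular systems -/

namespace ParentGraph

variable {d : ℕ} {G : ParentGraph d} {C M : Set (Fin d)} {Ω : Type*} [MeasurableSpace Ω]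
  {μ : Measure Ω} {A : Matrix (Fin d) (Fin d) ℝ} {Δ : Fin d → ℝ} {Y : Fin d → Ω → ℝ} {i k : Fin d}

namespace IsLinearTriangularSystem

theorem isEquationMatrix (hY : G.IsLinearTriangularSystem μ A Δ Y) : G.IsEquationMatrix A where
  diag := hY.diag
  edgeA_of_ne_zero i k h := or_iff_not_imp_left.2 fun hik =>
    by_contra fun harrow => h (hY.zero i k hik harrow)

theorem mul_cov_mul_transpose [IsFiniteMeasure μ] (hY : G.IsLinearTriangularSystem μ A Δ Y) :
    A * (Matrix.of fun r s => cov[Y r, Y s; μ]) * Aᵀ = Matrix.diagonal Δ := by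
  ext i k
  have h := hY.resid i k
  rw [covariance_fun_sum_fun_sum (fun j => (hY.memLp j).const_mul _)
    fun j => (hY.memLp j).const_mul _] at h
  rw [Matrix.diagonal_apply, ← h, Matrix.mul_apply, Finset.sum_comm]
  refine Finset.sum_congr rfl fun l _ => ?_
  rw [Matrix.mul_apply, Finset.sum_mul]
  refine Finset.sum_congr rfl fun j _ => ?_
  rw [covariance_const_mul_left, covariance_const_mul_right, Matrix.of_apply,
    Matrix.transpose_apply]
  ring

theorem freeOfDirectConfounding (hY : G.IsLinearTriangularSystem μ A Δ Y) (hi : i ∈ G.u C M)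
    (hki : k ≠ i) (hk : k ∉ M) (h : ¬ G.toMixed.HasActivePathBesidesArrow C M i k) :
    G.FreeOfDirectConfounding C M A Δ i k := by
  have hA : ¬ G.InducedArrow C M i k := mt (hasActivePath_of_inducedArrow hi hki hk) h
  have hW : ¬ G.edgeW C M i k := mt (hasActivePath_of_edgeW hi hki hk) h
  exact ⟨⟨fun hdashed => hW hdashed.2.2.2, hA⟩,
    paramH_eq_of_not_inducedArrow hY.isEquationMatrix hY.pos hi hk hA,
    fun _ => by_contra fun hne => hW (edgeW_of_ne_zero hY.isEquationMatrix hY.pos i k hne)⟩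

theorem freeOfIndirectConfounding [IsFiniteMeasure μ] (hY : G.IsLinearTriangularSystem μ A Δ Y)
    (hi : i ∈ G.u C M) (hk : k ∈ G.anc C M i ∪ G.v C M)
    (h : ¬ (G.summary C M).HasActivePathBesidesArrow (G.anc C M i) (G.marg C M i) i k) :
    G.FreeOfIndirectConfounding C M μ A Δ Y i k := by
  have hki : k ≠ i := fun hki => notMem_magRegressors hi (.inl (hki ▸ hk))
  have hkuv : k ∈ G.u C M ∨ k ∈ G.v C M := hk.imp_left And.left
  have hind : ¬ G.InducedByAncestors C M i k :=
    mt (hasActivePath_of_inducedByAncestors hi hki hkuv) h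
  refine ⟨hind, ?_⟩
  rw [magDependence, regressionCoef,
    partialInv_cov_eq_neg_magCoef hY.isEquationMatrix hY.pos hY.mul_cov_mul_transpose hi (.inl hk),
    magCoef_eq_paramH hY.isEquationMatrix hY.pos hi hkuv hind]

end IsLinearTriangularSystem

end ParentGraph

theorem corollary3 {d : ℕ} (G : ParentGraph d) (C M : Set (Fin d)) (hCM : Disjoint C M)
    {Ω : Type*} [MeasurableSpace Ω] (μ : Measure Ω) [IsProbabilityMeasure μ]
    (A : Matrix (Fin d) (Fin d) ℝ) (Δ : Fin d → ℝ) (Y : Fin d → Ω → ℝ)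
    (hY : G.IsLinearTriangularSystem μ A Δ Y)
    (i k : Fin d) (hik : G.arrow i k) (hi : i ∈ G.u C M) (hk : k ∉ C ∪ M) :
    (¬ G.toMixed.HasActivePathBesidesArrow C M i k →
        G.FreeOfDirectConfounding C M A Δ i k) ∧
    (¬ (G.summary C M).HasActivePathBesidesArrow (G.anc C M i) (G.marg C M i) i k →
        G.FreeOfIndirectConfounding C M μ A Δ Y i k) ∧
    (¬ G.toMixed.HasActivePathBesidesArrow C M i k →
      ¬ (G.summary C M).HasActivePathBesidesArrow (G.anc C M i) (G.marg C M i) i k →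
        G.magDependence C M μ Y i k = -A i k) := by
  have hki : k ≠ i := (G.lt_of_arrow i k hik).ne'
  have hkM : k ∉ M := fun h => hk (.inr h)
  have hkb : k ∈ G.anc C M i ∪ G.v C M :=
    (ParentGraph.mem_u_or_mem_v hk).imp_left (⟨·, .single hik⟩)
  refine ⟨fun hG => hY.freeOfDirectConfounding hi hki hkM hG,
    fun hsum => hY.freeOfIndirectConfounding hi hkb hsum, fun hG hsum => ?_⟩
  rw [(hY.freeOfIndirectConfounding hi hkb hsum).2,
    (hY.freeOfDirectConfounding hi hki hkM hG).2.1]
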